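/- Let $\mathbb{K}\in\{\mathbb{R},\mathbb{C}\}$. Let $H=\bigoplus_{n\ge 0}H_n$ be a graded and connected Hopf algebra over $\mathbb{K}$, i.e. a Hopf algebra with $H_nH_m\subseteq H_{n+m}$, $\Delta(H_n)\subseteq\bigoplus_{k+l=n}H_k\otimes H_l$ and $H_0\cong\mathbb{K}$. Let $J\subseteq H$ be a Hopf ideal (a two-sided ideal with $\epsilon(J)=0$, $\Delta(J)\subseteq J\otimes H+H\otimes J$, $S(J)\subseteq J$), and let $B$ be a commutative unital locally convex algebra over $\mathbb{K}$: a Hausdorff locally convex space with jointly continuous multiplication. Endow $\mathrm{Hom}_{\mathbb{K}}(H,B)$ with the convolution product $\star$ and the topology of pointwise convergence. Let $\mathrm{Char}(H,B)$ be the group (under $\star$) of unital algebra homomorphisms $H\to B$; let $\mathrm{InfChar}(H,B)$ be the Lie algebra, under the commutator of $\star$, of linear maps $\psi$ with $\psi(ab)=\psi(a)\epsilon(b)+\epsilon(a)\psi(b)$; and let $\mathrm{Ann}(J,B)=\{\phi\in\mathrm{Hom}_{\mathbb{K}}(H,B):\phi(J)=0\}$. Lie groups are modelled on Hausdorff locally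 convex spaces, and $C^r$-maps, $r\in\mathbb{N}_0\cup\{\infty\}$, are understood in the sense of Bastiani (the iterated directional derivatives exist and are jointly continuous). A map is $\mathbb{C}$-analytic if it is $C^\infty_{\mathbb{C}}$, and $\mathbb{R}$-analytic if it extends to a $C^\infty_{\mathbb{C}}$-map on a neighbourhood of its domain in the complexification. The global parametrisation $\exp\colon\mathrm{InfChar}(H,B)\to\mathrm{Char}(H,B)$, $\exp(\psi)=\sum_{k\ge 0}\psi^{\star k}/k!$, turns $\mathrm{Char}(H,B)$ into a $\mathbb{K}$-analytic Lie group with Lie algebra $\mathrm{InfChar}(H,B)$. With respect to this structure: 1. $\mathrm{Ann}(J,B)\cap\mathrm{Char}(H,B)$ is a closed Lie subgroup of $\mathrm{Char}(H,B)$ (a closed subgroup which is a $\mathbb{K}$-analytic submanifold, modelled on the closed subspace $\mathrm{Ann}(J,B)\cap\mathrm{InfChar}(H,B)$ of $\mathrm{InfChar}(H,B)$, and a $\mathbb{K}$-analytic Lie group for the induced structure). 2. Its Lie algebra, as a subalgebra of the Lie algebra $\mathrm{InfChar}(H,B)$ of $\mathrm{Char}(H,B)$, is $\mathrm{Ann}(J,B)\cap\mathrm{InfChar}(H,B)$.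 3. The Lie group $\mathrm{Ann}(J,B)\cap\mathrm{Char}(H,B)$ is an exponential Lie group (it has a smooth Lie group exponential map, and this is a diffeomorphism from the Lie algebra onto the group) and a BCH-Lie group (it is a $\mathbb{K}$-analytic Lie group whose exponential map is a local $\mathbb{K}$-analytic diffeomorphism at $0$). -/

import Mathlib

open Set Filter Topology TensorProduct
open scoped ContDiff RingTheory.LinearMap

/-! ## Differential calculus on locally convex spaces -/

section Complexification

/-- The complexification `E × E` of (the real space underlying) `E`; `(u, v)` stands for
`u + i v`. It carries the product topology. -/
def Complexification (𝕜 : Type*) (E : Type*) : Type _ :=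
  have _ := 𝕜
  E × E

variable (𝕜 : Type*) {E : Type*}

instance [TopologicalSpace E] : TopologicalSpace (Complexification 𝕜 E) :=
  inferInstanceAs (TopologicalSpace (E × E))

variable [AddCommGroup E]

instance : AddCommGroup (Complexification 𝕜 E) := inferInstanceAs (AddCommGroup (E × E))

theorem Complexification.add_fst (p q : Complexification 𝕜 E) : (p + q).1 = p.1 + q.1 := rfl

theorem Complexification.add_snd (p q : Complexification 𝕜 E) : (p + q).2 = p.2 + q.2 := rfl

theorem Complexification.zero_fst : (0 : Complexification 𝕜 E).1 = 0 := rfl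

theorem Complexification.zero_snd : (0 : Complexification 𝕜 E).2 = 0 := rfl

variable [RCLike 𝕜] [Module 𝕜 E]

instance : SMul ℂ (Complexification 𝕜 E) where
  smul z p := ((z.re : 𝕜) • p.1 - (z.im : 𝕜) • p.2, (z.re : 𝕜) • p.2 + (z.im : 𝕜) • p.1)

theorem Complexification.smul_fst (z : ℂ) (p : Complexification 𝕜 E) :
    (z • p).1 = (z.re : 𝕜) • p.1 - (z.im : 𝕜) • p.2 := rfl

theorem Complexification.smul_snd (z : ℂ) (p : Complexification 𝕜 E) :
    (z • p).2 = (z.re : 𝕜) • p.2 + (z.im : 𝕜) • p.1 := rfl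

instance : Module ℂ (Complexification 𝕜 E) where
  one_smul p := by
    refine Prod.ext ?_ ?_
    · rw [Complexification.smul_fst]; simp
    · rw [Complexification.smul_snd]; simp
  mul_smul z w p := by
    refine Prod.ext ?_ ?_
    · simp only [Complexification.smul_fst, Complexification.smul_snd, Complex.mul_re,
        Complex.mul_im, RCLike.ofReal_sub, RCLike.ofReal_add, RCLike.ofReal_mul]
      module
    · simp only [Complexification.smul_fst, Complexification.smul_snd, Complex.mul_re,
        Complex.mul_im, RCLike.ofReal_sub, RCLike.ofReal_add, RCLike.ofReal_mul]
      module
  smul_zero z := by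
    refine Prod.ext ?_ ?_
    · simp only [Complexification.smul_fst, Complexification.zero_fst,
        Complexification.zero_snd, smul_zero, sub_zero]
    · simp only [Complexification.smul_snd, Complexification.zero_fst,
        Complexification.zero_snd, smul_zero, add_zero]
  smul_add z p q := by
    refine Prod.ext ?_ ?_
    · simp only [Complexification.smul_fst, Complexification.add_fst, Complexification.add_snd]
      module
    · simp only [Complexification.smul_snd, Complexification.add_fst, Complexification.add_snd]
      module
  add_smul z w p := by
    refine Prod.ext ?_ ?_
    · simp only [Complexification.smul_fst, Complexification.add_fst, Complex.add_re,
        Complex.add_im, RCLike.ofReal_add]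
      module
    · simp only [Complexification.smul_snd, Complexification.add_snd, Complex.add_re,
        Complex.add_im, RCLike.ofReal_add]
      module
  zero_smul p := by
    refine Prod.ext ?_ ?_
    · rw [Complexification.smul_fst, Complexification.zero_fst]; simp
    · rw [Complexification.smul_snd, Complexification.zero_snd]; simp

/-- The inclusion `E = E × {0} ⊆ E_ℂ`. -/
def Complexification.ofBase (x : E) : Complexification 𝕜 E := ((x, 0) : E × E)

end Complexification

section Calculus

variable (𝕜 : Type*) [RCLike 𝕜]
variable {E : Type*} [AddCommGroup E] [Module 𝕜 E] [TopologicalSpace E]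
variable {F : Type*} [AddCommGroup F] [Module 𝕜 F] [TopologicalSpace F]

/-- Locally convex space: the topology is Hausdorff and generated by a family of seminorms
(which makes the vector space operations continuous). -/
structure IsLCSpace (𝕜 : Type*) [RCLike 𝕜] (E : Type*) [AddCommGroup E] [Module 𝕜 E]
    [TopologicalSpace E] : Prop where
  t2 : T2Space E
  polynormable : PolynormableSpace 𝕜 E

/-- The directional derivative `lim_{t → 0} t⁻¹ (f (x + t h) - f x)`, with `t ∈ 𝕜ˣ`, exists
and equals `v`. -/
def HasDirDeriv (f : E → F) (x h : E) (v : F) : Prop :=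
  Tendsto (fun t : 𝕜 => t⁻¹ • (f (x + t • h) - f x)) (𝓝[≠] 0) (𝓝 v)

/-- `f` is of class `C^r_𝕜`, `r ∈ ℕ ∪ {∞}`, on the (open) set `U` in the sense of Bastiani:
the iterated directional derivatives
`d k x (y₁, …, y_k) = (D_{y_k} ⋯ D_{y₁} f) x`, `k ≤ r`, exist and are continuous on `U × E ^ k`. -/
def IsBastiani (r : ℕ∞) (f : E → F) (U : Set E) : Prop :=
  ∃ d : (k : ℕ) → E → (Fin k → E) → F,
    (∀ x ∈ U, ∀ y, d 0 x y = f x) ∧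
    (∀ k : ℕ, ((k + 1 : ℕ) : ℕ∞) ≤ r → ∀ x ∈ U, ∀ (y : Fin k → E) (h : E),
      HasDirDeriv 𝕜 (fun z => d k z y) x h (d (k + 1) x (Fin.snoc y h : Fin (k + 1) → E))) ∧
    (∀ k : ℕ, (k : ℕ∞) ≤ r →
      ContinuousOn (fun p : E × (Fin k → E) => d k p.1 p.2) (U ×ˢ univ))

/-- `f` is real analytic on the (open) set `U`: it extends to a `C^∞_ℂ`-map on an open
neighbourhood of `U` in the complexification. -/
def IsRealAnalytic (f : E → F) (U : Set E) : Prop :=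
  ∃ (V : Set (Complexification 𝕜 E)) (g : Complexification 𝕜 E → Complexification 𝕜 F),
    IsOpen V ∧ (∀ x ∈ U, Complexification.ofBase 𝕜 x ∈ V) ∧ IsBastiani ℂ ⊤ g V ∧
    ∀ x ∈ U, g (Complexification.ofBase 𝕜 x) = Complexification.ofBase 𝕜 (f x)

/-- `f` is `𝕜`-analytic on the (open) set `U`: real analytic if `𝕜 = ℝ` (that is, if
`RCLike.I = 0` in `𝕜`), and `C^∞_ℂ` if `𝕜 = ℂ`. -/
def IsKAnalytic (f : E → F) (U : Set E) : Prop :=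
  ((RCLike.I : 𝕜) = 0 → IsRealAnalytic 𝕜 f U) ∧ ((RCLike.I : 𝕜) ≠ 0 → IsBastiani 𝕜 ⊤ f U)

/-- `f` is of class `C^r_𝕜` on the (open) set `U`, `r ∈ ℕ ∪ {∞, ω}`; here `ω = ⊤` stands for
`𝕜`-analytic maps. -/
def IsCk (r : WithTop ℕ∞) (f : E → F) (U : Set E) : Prop :=
  WithTop.recTopCoe (C := fun _ => Prop) (IsKAnalytic 𝕜 f U) (fun k => IsBastiani 𝕜 k f U) r

end Calculus

/-! ## Manifolds, Lie groups, Lie algebras and exponential maps -/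

section Manifolds

variable (𝕜 : Type*) [RCLike 𝕜] (r : WithTop ℕ∞)
variable {E : Type*} [AddCommGroup E] [Module 𝕜 E] [TopologicalSpace E]
variable {E' : Type*} [AddCommGroup E'] [Module 𝕜 E'] [TopologicalSpace E']
variable {M : Type*} [TopologicalSpace M] {M' : Type*} [TopologicalSpace M']

/-- The two charts are `C^r`-compatible. -/
def ChartCompatible (e e' : OpenPartialHomeomorph M E) : Prop :=
  IsCk 𝕜 r (e' ∘ e.symm) (e.symm.trans e').source ∧
  IsCk 𝕜 r (e ∘ e'.symm) (e'.symm.trans e).source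

/-- `A` is a `C^r`-atlas on `M` with charts in `E`. -/
structure IsLCAtlas (A : Set (OpenPartialHomeomorph M E)) : Prop where
  covers : ∀ x, ∃ e ∈ A, x ∈ e.source
  compatible : ∀ e ∈ A, ∀ e' ∈ A, ChartCompatible 𝕜 r e e'

/-- `M` is a (Hausdorff) locally convex `C^r`-manifold modelled on `E`, with atlas `A`. -/
structure IsLCManifold (A : Set (OpenPartialHomeomorph M E)) : Prop extends
    IsLCAtlas 𝕜 r A where
  hausdorff : T2Space M
  model : IsLCSpace 𝕜 E

/-- The charts that are `C^r`-compatible with all charts of the atlas `A`. -/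
def maxAtlas (A : Set (OpenPartialHomeomorph M E)) : Set (OpenPartialHomeomorph M E) :=
  {e | ∀ e' ∈ A, ChartCompatible 𝕜 r e e'}

/-- The atlas of product charts. -/
def prodAtlas (A : Set (OpenPartialHomeomorph M E)) (A' : Set (OpenPartialHomeomorph M' E')) :
    Set (OpenPartialHomeomorph (M × M') (E × E')) :=
  image2 (fun e e' => e.prod e') A A'

/-- The atlas of a topological vector space, consisting of the identity. -/
def idAtlas (E : Type*) [TopologicalSpace E] : Set (OpenPartialHomeomorph E E) :=
  {OpenPartialHomeomorph.refl E}

/-- `f` is a `C^r`-map from the open subset `U` of the manifold `M` to the manifold `M'`. -/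
def IsMfdMapOn (A : Set (OpenPartialHomeomorph M E)) (A' : Set (OpenPartialHomeomorph M' E'))
    (f : M → M') (U : Set M) : Prop :=
  IsOpen U ∧ ContinuousOn f U ∧ ∀ e ∈ A, ∀ e' ∈ A',
    IsCk 𝕜 r (e' ∘ f ∘ e.symm) (e.target ∩ e.symm ⁻¹' (U ∩ f ⁻¹' e'.source))

/-- Tangent vectors at `p`: a vector of the model space for each chart of `A` around `p`, which
transform by the derivatives of the changes of charts. -/
structure TangentVec (A : Set (OpenPartialHomeomorph M E)) (p : M) where
  coord : {e // e ∈ A ∧ p ∈ e.source} → E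
  compat : ∀ c c', HasDirDeriv 𝕜 (c'.1 ∘ c.1.symm) (c.1 p) (coord c) (coord c')

/-- The tangent map at `p` of `f` (with `f p = q`) sends the tangent vector `v` to `w`. -/
def HasTangentMap {A : Set (OpenPartialHomeomorph M E)} {A' : Set (OpenPartialHomeomorph M' E')}
    (f : M → M') {p : M} {q : M'} (v : TangentVec 𝕜 A p) (w : TangentVec 𝕜 A' q) : Prop :=
  f p = q ∧ ∀ c c', HasDirDeriv 𝕜 (c'.1 ∘ f ∘ c.1.symm) (c.1 p) (v.coord c) (w.coord c')

variable {G : Type*} [Group G] [TopologicalSpace G]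

/-- `G` with the atlas `A` is a `C^r`-Lie group: a Lie group for `r = ∞`, and a `𝕜`-analytic
Lie group for `r = ω`. -/
structure IsLCLieGroup (A : Set (OpenPartialHomeomorph G E)) : Prop where
  manifold : IsLCManifold 𝕜 r A
  mul : IsMfdMapOn 𝕜 r (prodAtlas A A) A (fun p : G × G => p.1 * p.2) univ
  inv : IsMfdMapOn 𝕜 r A A (fun g : G => g⁻¹) univ

/-- In the chart `e` around `1`, the vector field `X` is the left invariant vector field
`g ↦ T_1(λ_g) v` (where `λ_g x = g x`) determined by the tangent vector with coordinate `v`. -/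
def IsLeftInvariantField (e : OpenPartialHomeomorph G E) (v : E) (X : E → E) : Prop :=
  ∀ x ∈ e.target, HasDirDeriv 𝕜 (fun y => e (e.symm x * e.symm y)) (e 1) v (X x)

/-- In the chart `e` around `1`, the Lie bracket of the tangent vectors with coordinates `v, w`
is `z`: the value at `1` of `[X, Y] = dY(X) - dX(Y)`, for `X, Y` the left invariant vector fields
determined by `v, w`. -/
def HasLieBracket (e : OpenPartialHomeomorph G E) (v w z : E) : Prop :=
  ∃ (X Y : E → E) (a b : E), IsLeftInvariantField 𝕜 e v X ∧ IsLeftInvariantField 𝕜 e w Y ∧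
    HasDirDeriv 𝕜 Y (e 1) v a ∧ HasDirDeriv 𝕜 X (e 1) w b ∧ z = a - b

variable {L : Type*} [LieRing L] [LieAlgebra 𝕜 L] [TopologicalSpace L]

/-- `τ` identifies the topological Lie algebra `L` with the Lie algebra `T_1 G` of `G`. (A tangent
vector is determined by its coordinate in any one chart, and every vector occurs.) -/
structure IsLieAlgebraOf (A : Set (OpenPartialHomeomorph G E)) (τ : L → TangentVec 𝕜 A (1 : G)) :
    Prop where
  linear : ∀ c, IsLinearMap 𝕜 (fun v => (τ v).coord c)
  homeo : ∀ c, IsHomeomorph (fun v => (τ v).coord c)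
  bracket : ∀ v w c, HasLieBracket 𝕜 c.1 ((τ v).coord c) ((τ w).coord c) ((τ ⁅v, w⁆).coord c)

/-- `exp : L → G` is the smooth exponential map of the Lie group `G` with Lie algebra `L`
(identified with `T_1 G` by `τ`): for every `v`, the map `t ↦ exp (t v)` is the smooth
one-parameter group `ℝ → G` with velocity `v` at `0`; and `exp` is smooth. -/
def IsSmoothLieExp (A : Set (OpenPartialHomeomorph G E)) (τ : L → TangentVec 𝕜 A (1 : G))
    (exp : L → G) : Prop :=
  letI : Module ℝ E := Module.compHom E (algebraMap ℝ 𝕜)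
  (∀ v : L,
    (∀ s t : ℝ, exp (((s + t : ℝ) : 𝕜) • v) = exp ((s : 𝕜) • v) * exp ((t : 𝕜) • v)) ∧
    IsMfdMapOn ℝ ∞ (idAtlas ℝ) A (fun t : ℝ => exp ((t : 𝕜) • v)) univ ∧
    ∀ c : {e // e ∈ A ∧ (1 : G) ∈ e.source},
      HasDirDeriv ℝ (fun t : ℝ => c.1 (exp ((t : 𝕜) • v))) 0 1 ((τ v).coord c)) ∧
  IsMfdMapOn 𝕜 ∞ (idAtlas L) A exp univ

/-- `G` is an exponential Lie group: its exponential map is a (global) diffeomorphism. -/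
def IsExponentialLieGroup (A : Set (OpenPartialHomeomorph G E))
    (τ : L → TangentVec 𝕜 A (1 : G)) : Prop :=
  IsLCLieGroup 𝕜 ∞ A ∧ IsLieAlgebraOf 𝕜 A τ ∧
  ∃ (exp : L → G) (log : G → L), IsSmoothLieExp 𝕜 A τ exp ∧
    Function.LeftInverse log exp ∧ Function.RightInverse log exp ∧
    IsMfdMapOn 𝕜 ∞ A (idAtlas L) log univ

/-- `G` is a BCH-Lie group: it is a `𝕜`-analytic Lie group with smooth exponential map, which is
a local `𝕜`-analytic diffeomorphism at `0`. -/
def IsBCHLieGroup (A : Set (OpenPartialHomeomorph G E))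
    (τ : L → TangentVec 𝕜 A (1 : G)) : Prop :=
  IsLCLieGroup 𝕜 ω A ∧ IsLieAlgebraOf 𝕜 A τ ∧
  ∃ exp : L → G, IsSmoothLieExp 𝕜 A τ exp ∧
    ∃ φ : OpenPartialHomeomorph L G, 0 ∈ φ.source ∧ EqOn exp φ φ.source ∧
      IsMfdMapOn 𝕜 ω (idAtlas L) A φ φ.source ∧ IsMfdMapOn 𝕜 ω A (idAtlas L) φ.symm φ.target

/-- The subgroup `S` of the Lie group `G` is a Lie subgroup: it is a submanifold modelled on the
closed subspace `F ⊆ E`, and a Lie group for the induced manifold structure. The atlas `A'` of `S`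
consists of restrictions of charts `e` of the manifold `G` adapted to `S`, i.e. with
`e (U ∩ S) = e (U) ∩ F` where `U` is the domain of `e`. -/
structure IsLieSubgroup (A : Set (OpenPartialHomeomorph G E)) (S : Subgroup G)
    (F : Submodule 𝕜 E) (A' : Set (OpenPartialHomeomorph S F)) : Prop where
  closed_model : IsClosed (F : Set E)
  induced : ∀ e' ∈ A', ∃ e ∈ maxAtlas 𝕜 r A,
    (∀ x ∈ e.source, x ∈ S ↔ e x ∈ F) ∧ (∀ y : S, y ∈ e'.source ↔ (y : G) ∈ e.source) ∧
    ∀ y ∈ e'.source, (e' y : E) = e y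
  lieGroup : IsLCLieGroup 𝕜 r A'

end Manifolds

/-! ## Hopf algebras, characters and infinitesimal characters -/

section Hopf

variable (𝕜 : Type*) [RCLike 𝕜] (H : Type*) [Ring H] [HopfAlgebra 𝕜 H]
variable (B : Type*) [CommRing B] [Algebra 𝕜 B]

/-- The subspaces `𝒢 n` are a grading which makes `H` a graded and connected Hopf algebra. -/
structure IsConnectedHopfGrading {H : Type*} [Ring H] [HopfAlgebra 𝕜 H] (𝒢 : ℕ → Submodule 𝕜 H) :
    Prop where
  internal : DirectSum.IsInternal 𝒢
  mul_mem : ∀ n m, ∀ a ∈ 𝒢 n, ∀ b ∈ 𝒢 m, a * b ∈ 𝒢 (n + m)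
  comul_mem : ∀ n, ∀ a ∈ 𝒢 n, Coalgebra.comul (R := 𝕜) a ∈
    ⨆ (k : ℕ) (l : ℕ) (_ : k + l = n),
      LinearMap.range (TensorProduct.map (𝒢 k).subtype (𝒢 l).subtype)
  connected : Nonempty (𝒢 0 ≃ₗ[𝕜] 𝕜)

/-- `Hom_𝕜 (H, B)`; multiplication is convolution. -/
abbrev ConvHom : Type _ := WithConv (H →ₗ[𝕜] B)

/-- The commutator bracket of the convolution. -/
noncomputable instance ConvHom.lieRing : LieRing (ConvHom 𝕜 H B) := LieRing.ofAssociativeRing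

noncomputable instance ConvHom.lieAlgebra : LieAlgebra 𝕜 (ConvHom 𝕜 H B) :=
  LieAlgebra.ofAssociativeAlgebra

/-- The topology of pointwise convergence. -/
instance ConvHom.topology [TopologicalSpace B] : TopologicalSpace (ConvHom 𝕜 H B) :=
  TopologicalSpace.induced (fun (φ : ConvHom 𝕜 H B) (x : H) => φ x) inferInstance

/-- `Char (H, B)`, the set of unital algebra homomorphisms `H → B`. -/
def CharGroup : Type _ := WithConv (H →ₐ[𝕜] B)

variable {H} in
theorem CharGroup.antipode_mul_map (φ : H →ₐ[𝕜] B) (a b : H) :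
    φ (HopfAlgebra.antipode 𝕜 (a * b)) =
      φ (HopfAlgebra.antipode 𝕜 a) * φ (HopfAlgebra.antipode 𝕜 b) := by
  rw [HopfAlgebra.antipode_mul_antidistrib, map_mul, mul_comm]

variable {𝕜 H B}

/-- A character as a linear map. -/
def CharGroup.toHom (φ : CharGroup 𝕜 H B) : ConvHom 𝕜 H B :=
  WithConv.toConv (WithConv.ofConv φ).toLinearMap

theorem CharGroup.toHom_injective :
    Function.Injective (CharGroup.toHom : CharGroup 𝕜 H B → ConvHom 𝕜 H B) := fun _ _ h =>
  WithConv.ofConv_injective (AlgHom.toLinearMap_injective (WithConv.toConv_injective h))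

/-- The group structure: convolution, with inverse `φ ∘ S`. -/
noncomputable instance CharGroup.group : Group (CharGroup 𝕜 H B) where
  __ := (inferInstance : Monoid (WithConv (H →ₐ[𝕜] B)))
  inv φ := WithConv.toConv <| AlgHom.ofLinearMap
    ((WithConv.ofConv φ).toLinearMap ∘ₗ HopfAlgebra.antipode 𝕜)
    (by simp) (fun a b => by simpa using CharGroup.antipode_mul_map 𝕜 B (WithConv.ofConv φ) a b)
  inv_mul_cancel φ := by
    apply CharGroup.toHom_injective
    have h := LinearMap.algHom_comp_convMul_distrib (WithConv.ofConv φ)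
      (WithConv.toConv (HopfAlgebra.antipode 𝕜 (A := H))) (WithConv.toConv LinearMap.id)
    rw [LinearMap.antipode_mul_id] at h
    apply WithConv.ofConv_injective
    refine Eq.trans h.symm ?_
    ext x
    exact (WithConv.ofConv φ).commutes _

theorem CharGroup.toHom_mul (φ ψ : CharGroup 𝕜 H B) :
    (φ * ψ).toHom = φ.toHom * ψ.toHom := rfl

theorem CharGroup.toHom_one : (1 : CharGroup 𝕜 H B).toHom = 1 := rfl

theorem CharGroup.toHom_inv (φ : CharGroup 𝕜 H B) (x : H) :
    φ⁻¹.toHom x = φ.toHom (HopfAlgebra.antipode 𝕜 x) := rfl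

instance CharGroup.topology [TopologicalSpace B] : TopologicalSpace (CharGroup 𝕜 H B) :=
  TopologicalSpace.induced CharGroup.toHom inferInstance

theorem ConvHom.mul_map_mul {ψ χ : ConvHom 𝕜 H B}
    (hψ : ∀ a b : H, ψ (a * b) =
      Coalgebra.counit (R := 𝕜) b • ψ a + Coalgebra.counit (R := 𝕜) a • ψ b)
    (hχ : ∀ a b : H, χ (a * b) =
      Coalgebra.counit (R := 𝕜) b • χ a + Coalgebra.counit (R := 𝕜) a • χ b) (a b : H) :
    (ψ * χ) (a * b) = Coalgebra.counit (R := 𝕜) b • (ψ * χ) a +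
      Coalgebra.counit (R := 𝕜) a • (ψ * χ) b + (ψ a * χ b + ψ b * χ a) := by
  have key : ∀ (φ : ConvHom 𝕜 H B) (x : H),
      ∑ i ∈ (Coalgebra.Repr.arbitrary 𝕜 x).index,
        Coalgebra.counit (R := 𝕜) ((Coalgebra.Repr.arbitrary 𝕜 x).left i) •
          φ ((Coalgebra.Repr.arbitrary 𝕜 x).right i) = φ x := by
    intro φ x
    have h := congrArg (fun y => φ y)
      (Coalgebra.sum_counit_smul (Coalgebra.Repr.arbitrary 𝕜 x))
    simpa [map_sum] using h
  have key' : ∀ (φ : ConvHom 𝕜 H B) (x : H),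
      ∑ i ∈ (Coalgebra.Repr.arbitrary 𝕜 x).index,
        Coalgebra.counit (R := 𝕜) ((Coalgebra.Repr.arbitrary 𝕜 x).right i) •
          φ ((Coalgebra.Repr.arbitrary 𝕜 x).left i) = φ x := by
    intro φ x
    have h := congrArg (fun φ' : ConvHom 𝕜 H B => φ' x) (mul_one φ)
    rw [(Coalgebra.Repr.arbitrary 𝕜 x).convMul_apply] at h
    simpa [Algebra.smul_def, mul_comm] using h
  have keye : ∀ x : H,
      ∑ i ∈ (Coalgebra.Repr.arbitrary 𝕜 x).index,
        Coalgebra.counit (R := 𝕜) ((Coalgebra.Repr.arbitrary 𝕜 x).left i) *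
          Coalgebra.counit (R := 𝕜) ((Coalgebra.Repr.arbitrary 𝕜 x).right i) =
        Coalgebra.counit (R := 𝕜) x := by
    intro x
    have h := congrArg (fun y => Coalgebra.counit (R := 𝕜) y)
      (Coalgebra.sum_counit_smul (Coalgebra.Repr.arbitrary 𝕜 x))
    simpa [map_sum] using h
  set ra := Coalgebra.Repr.arbitrary 𝕜 a with hra
  set rb := Coalgebra.Repr.arbitrary 𝕜 b with hrb
  have hab : (ψ * χ) (a * b) = ∑ i ∈ ra.index, ∑ j ∈ rb.index,
      ψ (ra.left i * rb.left j) * χ (ra.right i * rb.right j) := by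
    have h := (ra.mul rb).convMul_apply ψ χ
    rw [h]
    exact Finset.sum_product _ _ _
  have e1 : ∀ (f g : _ → B), (∑ i ∈ ra.index, f i) * (∑ j ∈ rb.index, g j) =
      ∑ i ∈ ra.index, ∑ j ∈ rb.index, f i * g j := fun f g => Finset.sum_mul_sum _ _ _ _
  have t1 : Coalgebra.counit (R := 𝕜) b • (ψ * χ) a = ∑ i ∈ ra.index, ∑ j ∈ rb.index,
      (ψ (ra.left i) * χ (ra.right i)) * algebraMap 𝕜 B
        (Coalgebra.counit (R := 𝕜) (rb.left j) * Coalgebra.counit (R := 𝕜) (rb.right j)) := by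
    rw [← e1, ← map_sum, keye, ra.convMul_apply, Algebra.smul_def, mul_comm]
  have t2 : Coalgebra.counit (R := 𝕜) a • (ψ * χ) b = ∑ i ∈ ra.index, ∑ j ∈ rb.index,
      algebraMap 𝕜 B
        (Coalgebra.counit (R := 𝕜) (ra.left i) * Coalgebra.counit (R := 𝕜) (ra.right i)) *
      (ψ (rb.left j) * χ (rb.right j)) := by
    rw [← e1, ← map_sum, keye, rb.convMul_apply, Algebra.smul_def]
  have t3 : ψ a * χ b = ∑ i ∈ ra.index, ∑ j ∈ rb.index,
      (Coalgebra.counit (R := 𝕜) (ra.right i) • ψ (ra.left i)) *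
        (Coalgebra.counit (R := 𝕜) (rb.left j) • χ (rb.right j)) := by
    rw [← e1, key' ψ a, key χ b]
  have t4 : ψ b * χ a = ∑ i ∈ ra.index, ∑ j ∈ rb.index,
      (Coalgebra.counit (R := 𝕜) (ra.left i) • χ (ra.right i)) *
        (Coalgebra.counit (R := 𝕜) (rb.right j) • ψ (rb.left j)) := by
    rw [← e1, key' ψ b, key χ a, mul_comm]
  rw [hab, t1, t2, t3, t4]
  simp only [← Finset.sum_add_distrib]
  refine Finset.sum_congr rfl fun i _ => Finset.sum_congr rfl fun j _ => ?_
  rw [hψ, hχ]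
  simp only [Algebra.smul_def, map_mul]
  ring

variable (𝕜 H B) in
/-- The Lie algebra `InfChar (H, B)` of infinitesimal characters, with the commutator bracket of
the convolution. -/
def infChar : LieSubalgebra 𝕜 (ConvHom 𝕜 H B) where
  carrier := {ψ | ∀ a b : H, ψ (a * b) =
    Coalgebra.counit (R := 𝕜) b • ψ a + Coalgebra.counit (R := 𝕜) a • ψ b}
  zero_mem' := by intro a b; simp
  add_mem' := by
    intro ψ χ hψ hχ a b
    have h1 := hψ a b
    have h2 := hχ a b
    simp only [WithConv.ofConv_add, LinearMap.add_apply, h1, h2]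
    module
  smul_mem' := by
    intro c ψ hψ a b
    have h1 := hψ a b
    simp only [WithConv.ofConv_smul, LinearMap.smul_apply, h1]
    module
  lie_mem' := by
    intro ψ χ hψ hχ a b
    rw [LieRing.of_associative_ring_bracket]
    simp only [WithConv.ofConv_sub, LinearMap.sub_apply, ConvHom.mul_map_mul hψ hχ,
      ConvHom.mul_map_mul hχ hψ, mul_comm (χ a), mul_comm (χ b)]
    module

variable (J : Ideal H) [J.IsHopfIdeal 𝕜]

/-- The annihilator `Ann (J, B)` is closed under convolution. -/
theorem ConvHom.ann_mul {ψ χ : ConvHom 𝕜 H B} (hψ : ∀ x ∈ J, ψ x = 0) (hχ : ∀ x ∈ J, χ x = 0)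
    {x : H} (hx : x ∈ J) : (ψ * χ) x = 0 := by
  have hc : (J.restrictScalars 𝕜).IsCoideal := inferInstance
  have h := ((Submodule.isCoideal_iff_comul_mem (J.restrictScalars 𝕜)).1 hc).2 x hx
  rw [LinearMap.convMul_apply]
  suffices hle : LinearMap.range (LinearMap.lTensor H (J.restrictScalars 𝕜).subtype) ⊔
      LinearMap.range (LinearMap.rTensor H (J.restrictScalars 𝕜).subtype) ≤
      LinearMap.ker (LinearMap.mul' 𝕜 B ∘ₗ TensorProduct.map ψ.ofConv χ.ofConv) from
    LinearMap.mem_ker.1 (hle h)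
  rw [sup_le_iff, LinearMap.range_le_ker_iff, LinearMap.range_le_ker_iff]
  constructor
  · refine TensorProduct.ext' fun y z => ?_
    have := hχ z.1 z.2
    simp [this]
  · refine TensorProduct.ext' fun y z => ?_
    have := hψ y.1 y.2
    simp [this]

variable (𝕜 B) in
/-- `Ann (J, B) ∩ Char (H, B)`. -/
def annChar : Subgroup (CharGroup 𝕜 H B) where
  carrier := {φ | ∀ x ∈ J, φ.toHom x = 0}
  one_mem' := by
    intro x hx
    have h : Coalgebra.counit (R := 𝕜) x = 0 :=
      Submodule.IsCoideal.counit_eq_zero (I := J.restrictScalars 𝕜) hx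
    rw [CharGroup.toHom_one, LinearMap.convOne_apply, h, map_zero]
  mul_mem' := by
    intro φ ψ hφ hψ x hx
    rw [CharGroup.toHom_mul]
    exact ConvHom.ann_mul J hφ hψ hx
  inv_mem' := by
    intro φ hφ x hx
    rw [CharGroup.toHom_inv]
    exact hφ _ (Ideal.IsHopfIdeal.antipode_mem (R := 𝕜) hx)

variable (𝕜 B) in
/-- `Ann (J, B) ∩ InfChar (H, B)`, as a Lie subalgebra of `InfChar (H, B)`. -/
def annInfChar : LieSubalgebra 𝕜 (infChar 𝕜 H B) where
  carrier := {ψ | ∀ x ∈ J, (ψ : ConvHom 𝕜 H B) x = 0}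
  zero_mem' := by intro x _; rfl
  add_mem' := by
    intro ψ χ hψ hχ x hx
    have h1 := hψ x hx
    have h2 := hχ x hx
    simp [h1, h2]
  smul_mem' := by
    intro c ψ hψ x hx
    have h1 := hψ x hx
    simp [h1]
  lie_mem' := by
    intro ψ χ hψ hχ x hx
    rw [LieSubalgebra.coe_bracket, LieRing.of_associative_ring_bracket]
    simp only [WithConv.ofConv_sub, LinearMap.sub_apply]
    rw [ConvHom.ann_mul J hψ hχ hx, ConvHom.ann_mul J hχ hψ hx, sub_zero]

variable (𝕜 H B) in
/-- The manifold structure on `Char (H, B)` induced by the global parametrisation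
`exp : InfChar (H, B) → Char (H, B)`, `exp ψ = ∑ ψ ^ k / k!` (convolution powers): the only chart
is the homeomorphism `exp⁻¹`. -/
def expAtlas [TopologicalSpace B] :
    Set (OpenPartialHomeomorph (CharGroup 𝕜 H B) (infChar 𝕜 H B)) :=
  {e | e.source = univ ∧ e.target = univ ∧ ∀ ψ : infChar 𝕜 H B,
    HasSum (fun k : ℕ => ((k.factorial : 𝕜)⁻¹) • (ψ : ConvHom 𝕜 H B) ^ k) (e.symm ψ).toHom}

end Hopf

/-! Everything rests on one finiteness fact. Since `H` is connected, a linear map with `χ 1 = 0`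
vanishes on `H_0 = 𝕜 1`. Since `Δ` respects the grading, `χ ^ k` then vanishes on `H_m` for `m < k`
(`IsConnectedHopfGrading.isConilpotent`). Hence every power series can be evaluated at `χ`,
pointwise by finite sums whose length depends on the point of `H` but not on `χ` or on the target
algebra.

For a character `φ`, the value `φ ^ n` at `x` is the binomial expansion of `(1 + (φ - 1)) ^ n`, so
it is a polynomial in `n`, and its linear coefficient is `log φ` at `x`. Polynomials are determined
by their values at natural numbers, so identities between powers become identities between
coefficients. This shows that `exp` and `log` are mutually inverse and that `log` turns characters
into infinitesimal characters. That `exp` maps infinitesimal characters to characters is the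
binomial theorem on `H ⊗ H`, because composing `ψ` with the multiplication gives `ψ ⊗ ε + ε ⊗ ψ`, a
sum of commuting elements.

The coideal property makes `Ann (J, B)` closed under convolution, so `exp` and `log` restrict to the
maps vanishing on, respectively agreeing with the counit on, `J`. The whole group (`J = ∅`) and the
annihilator subgroup are thus two instances of `IsCharModel`, and the Lie theory is done once, in
the global chart `log`. There inversion is negation, one-parameter groups are lines, and
multiplication is `(ψ, χ) ↦ log (exp ψ * exp χ)`. Each evaluation of the latter is a polynomial in
finitely many evaluations of `ψ` and `χ`, hence smooth. The same formula with values in the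
complexification of `B` is the complex extension that real analyticity asks for. Expanding this
product to second order gives the commutator as Lie bracket. Since both charts are logarithms, the
chart of the subgroup is the restriction of the chart of the big group, which gives the submanifold
property. -/

/-! ### Power series in the convolution algebra, exponential and logarithm -/

section ConvolutionSeries

variable {𝕜 : Type*} [RCLike 𝕜] {H : Type*} [Ring H] [HopfAlgebra 𝕜 H]
variable {C : Type*} [CommRing C] [Algebra 𝕜 C]

/-- Pointwise nilpotent elements of the convolution algebra. -/
def IsPointwiseNilpotent (χ : ConvHom 𝕜 H C) : Prop :=
  ∀ x : H, ∃ n : ℕ, ∀ k, n ≤ k → (χ ^ k) x = 0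

theorem ConvHom.coe_smul (c : 𝕜) (φ : ConvHom 𝕜 H C) (x : H) : (c • φ) x = c • φ x := rfl

theorem ConvHom.coe_sum {ι : Type*} (s : Finset ι) (φ : ι → ConvHom 𝕜 H C) (x : H) :
    (∑ i ∈ s, φ i) x = ∑ i ∈ s, φ i x := by
  rw [WithConv.ofConv_sum, LinearMap.sum_apply]

theorem ConvHom.ext_apply {φ ψ : ConvHom 𝕜 H C} (h : ∀ x, φ x = ψ x) : φ = ψ :=
  WithConv.ext (LinearMap.ext h)

theorem ConvHom.mul_apply_repr (φ ψ : ConvHom 𝕜 H C) (x : H) :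
    (φ * ψ) x = ∑ i ∈ (Coalgebra.Repr.arbitrary 𝕜 x).index,
      φ ((Coalgebra.Repr.arbitrary 𝕜 x).left i) * ψ ((Coalgebra.Repr.arbitrary 𝕜 x).right i) :=
  (Coalgebra.Repr.arbitrary 𝕜 x).convMul_apply φ ψ

theorem ConvHom.mul_apply_one (φ ψ : ConvHom 𝕜 H C) : (φ * ψ) 1 = φ 1 * ψ 1 := by
  simp [LinearMap.convMul_apply, Algebra.TensorProduct.one_def]

theorem ConvHom.one_apply_one : (1 : ConvHom 𝕜 H C) 1 = 1 := by simp

theorem ConvHom.pow_apply_one (φ : ConvHom 𝕜 H C) (n : ℕ) : (φ ^ n) 1 = (φ 1) ^ n := by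
  induction n with
  | zero => simp
  | succ n ih => rw [pow_succ, ConvHom.mul_apply_one, ih, pow_succ]

theorem IsPointwiseNilpotent.smul {χ : ConvHom 𝕜 H C} (h : IsPointwiseNilpotent χ) (c : 𝕜) :
    IsPointwiseNilpotent (c • χ) := by
  intro x
  obtain ⟨n, hn⟩ := h x
  refine ⟨n, fun k hk => ?_⟩
  rw [smul_pow, ConvHom.coe_smul, hn k hk, smul_zero]

theorem IsPointwiseNilpotent.exists_forall_finset {χ : ConvHom 𝕜 H C}
    (h : IsPointwiseNilpotent χ) {ι : Type*} (s : Finset ι) (x : ι → H) :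
    ∃ n : ℕ, ∀ i ∈ s, ∀ k, n ≤ k → (χ ^ k) (x i) = 0 := by
  choose N hN using fun i => h (x i)
  exact ⟨s.sup N, fun i hi k hk => hN i k ((Finset.le_sup (f := N) hi).trans hk)⟩

theorem finsum_smul_pow_apply {χ : ConvHom 𝕜 H C} (f : PowerSeries 𝕜) {x : H} {n : ℕ}
    (hn : ∀ k, n ≤ k → (χ ^ k) x = 0) :
    ∑ᶠ k : ℕ, PowerSeries.coeff k f • (χ ^ k) x =
      ∑ k ∈ Finset.range n, PowerSeries.coeff k f • (χ ^ k) x := by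
  refine finsum_eq_sum_of_support_subset _ fun k hk => ?_
  rw [Finset.mem_coe, Finset.mem_range]
  by_contra h
  exact hk (by simp only [hn k (not_lt.1 h), smul_zero])

open Classical in
/-- The value of a power series at a pointwise nilpotent element of the convolution algebra. -/
noncomputable def convSeries (f : PowerSeries 𝕜) (χ : ConvHom 𝕜 H C) : ConvHom 𝕜 H C :=
  if h : IsPointwiseNilpotent χ then WithConv.toConv
    { toFun := fun x => ∑ᶠ k : ℕ, PowerSeries.coeff k f • (χ ^ k) x
      map_add' := by
        intro x y
        obtain ⟨n, hn⟩ := h x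
        obtain ⟨m, hm⟩ := h y
        have hx : ∀ k, max n m ≤ k → (χ ^ k) x = 0 := fun k hk => hn k (le_of_max_le_left hk)
        have hy : ∀ k, max n m ≤ k → (χ ^ k) y = 0 := fun k hk => hm k (le_of_max_le_right hk)
        have hxy : ∀ k, max n m ≤ k → (χ ^ k) (x + y) = 0 := fun k hk => by
          rw [map_add, hx k hk, hy k hk, add_zero]
        rw [finsum_smul_pow_apply f hx, finsum_smul_pow_apply f hy, finsum_smul_pow_apply f hxy,
          ← Finset.sum_add_distrib]
        simp only [map_add, smul_add]
      map_smul' := by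
        intro c x
        obtain ⟨n, hn⟩ := h x
        have hcx : ∀ k, n ≤ k → (χ ^ k) (c • x) = 0 := fun k hk => by
          rw [map_smul, hn k hk, smul_zero]
        rw [finsum_smul_pow_apply f hn, finsum_smul_pow_apply f hcx, RingHom.id_apply,
          Finset.smul_sum]
        simp only [map_smul, smul_comm c] }
  else 0

theorem convSeries_apply {χ : ConvHom 𝕜 H C} (h : IsPointwiseNilpotent χ) (f : PowerSeries 𝕜)
    {x : H} {n : ℕ} (hn : ∀ k, n ≤ k → (χ ^ k) x = 0) :
    convSeries f χ x = ∑ k ∈ Finset.range n, PowerSeries.coeff k f • (χ ^ k) x := by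
  rw [← finsum_smul_pow_apply f hn, convSeries, dif_pos h]
  rfl

/-- At a fixed `x` only the coefficients below the order of nilpotency matter, so the series may be
replaced by any polynomial with those coefficients. Algebraic identities then come from the ring
homomorphism `Polynomial.aeval`. -/
theorem convSeries_apply_eq_aeval {χ : ConvHom 𝕜 H C} (h : IsPointwiseNilpotent χ)
    (f : PowerSeries 𝕜) {x : H} {n : ℕ} (hn : ∀ k, n ≤ k → (χ ^ k) x = 0) (p : Polynomial 𝕜)
    (hp : ∀ k < n, p.coeff k = PowerSeries.coeff k f) :
    convSeries f χ x = (Polynomial.aeval χ p) x := by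
  have hd : p.natDegree < max n (p.natDegree + 1) := lt_max_of_lt_right (Nat.lt_succ_self _)
  rw [convSeries_apply h f hn, Polynomial.aeval_eq_sum_range' hd, ConvHom.coe_sum]
  rw [← Finset.sum_subset (Finset.range_subset_range.2 (le_max_left n (p.natDegree + 1)))]
  · refine Finset.sum_congr rfl fun k hk => ?_
    rw [ConvHom.coe_smul, hp k (Finset.mem_range.1 hk)]
  · intro k _ hk
    rw [ConvHom.coe_smul, hn k (not_lt.1 fun h => hk (Finset.mem_range.2 h)), smul_zero]

/-- The product at `x` involves the two factors at the tensor legs of `Δ x`. Truncating both series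
at an order `M` beyond the nilpotency orders at `x` and at these finitely many legs changes none of
the values. -/
theorem convSeries_mul {χ : ConvHom 𝕜 H C} (h : IsPointwiseNilpotent χ) (f g : PowerSeries 𝕜) :
    convSeries (f * g) χ = convSeries f χ * convSeries g χ := by
  refine ConvHom.ext_apply fun x => ?_
  set r := Coalgebra.Repr.arbitrary 𝕜 x with hr
  obtain ⟨n₀, hn₀⟩ := h x
  obtain ⟨n₁, hn₁⟩ := h.exists_forall_finset r.index r.left
  obtain ⟨n₂, hn₂⟩ := h.exists_forall_finset r.index r.right
  set M := max n₀ (max n₁ n₂) with hM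
  have h0 : n₀ ≤ M := le_max_left _ _
  have h1 : n₁ ≤ M := (le_max_left _ _).trans (le_max_right _ _)
  have h2 : n₂ ≤ M := (le_max_right _ _).trans (le_max_right _ _)
  have hco : ∀ g : PowerSeries 𝕜, ∀ k < M, (PowerSeries.trunc M g).coeff k =
      PowerSeries.coeff k g := fun g k hk => by rw [PowerSeries.coeff_trunc, if_pos hk]
  rw [convSeries_apply_eq_aeval h (f * g) (fun k hk => hn₀ k (h0.trans hk))
    (PowerSeries.trunc M f * PowerSeries.trunc M g) (fun k hk => by
      rw [PowerSeries.coeff_mul_eq_coeff_trunc_mul_trunc f g hk, ← Polynomial.coe_mul,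
        Polynomial.coeff_coe]), map_mul, ConvHom.mul_apply_repr, ConvHom.mul_apply_repr]
  refine Finset.sum_congr rfl fun i hi => ?_
  rw [← convSeries_apply_eq_aeval h f (fun k hk => hn₁ i hi k (h1.trans hk)) _ (hco f),
    ← convSeries_apply_eq_aeval h g (fun k hk => hn₂ i hi k (h2.trans hk)) _ (hco g)]

theorem convSeries_one {χ : ConvHom 𝕜 H C} (h : IsPointwiseNilpotent χ) :
    convSeries 1 χ = 1 := by
  refine ConvHom.ext_apply fun x => ?_
  obtain ⟨n, hn⟩ := h x
  rw [convSeries_apply_eq_aeval h 1 hn 1 (fun k _ => by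
    rw [← Polynomial.coe_one, Polynomial.coeff_coe]), map_one]

theorem convSeries_rescale {χ : ConvHom 𝕜 H C} (h : IsPointwiseNilpotent χ) (c : 𝕜)
    (f : PowerSeries 𝕜) : convSeries (PowerSeries.rescale c f) χ = convSeries f (c • χ) := by
  refine ConvHom.ext_apply fun x => ?_
  obtain ⟨n, hn⟩ := h x
  rw [convSeries_apply h _ hn, convSeries_apply (h.smul c) f (n := n) (fun k hk => by
    rw [smul_pow, ConvHom.coe_smul, hn k hk, smul_zero])]
  refine Finset.sum_congr rfl fun k _ => ?_
  rw [smul_pow, ConvHom.coe_smul, PowerSeries.coeff_rescale, smul_smul, mul_comm]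

theorem convSeries_apply_one {χ : ConvHom 𝕜 H C} (h : IsPointwiseNilpotent χ) (h1 : χ 1 = 0)
    (f : PowerSeries 𝕜) : convSeries f χ 1 = PowerSeries.coeff 0 f • 1 := by
  rw [convSeries_apply h f (n := 1) (fun k hk => by
    rw [ConvHom.pow_apply_one, h1, zero_pow (by omega)])]
  simp

/-! ### Exponential and logarithm -/

/-- The exponential of a pointwise nilpotent element of the convolution algebra. -/
noncomputable def convExp (ψ : ConvHom 𝕜 H C) : ConvHom 𝕜 H C := convSeries (PowerSeries.exp 𝕜) ψ

theorem coeff_exp_eq (k : ℕ) :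
    PowerSeries.coeff k (PowerSeries.exp 𝕜) = ((k.factorial : 𝕜))⁻¹ := by
  rw [PowerSeries.coeff_exp]; simp

theorem convExp_add_smul {ψ : ConvHom 𝕜 H C} (h : IsPointwiseNilpotent ψ) (s t : 𝕜) :
    convExp ((s + t) • ψ) = convExp (s • ψ) * convExp (t • ψ) := by
  simp only [convExp, ← convSeries_rescale h]
  rw [← PowerSeries.exp_mul_exp_eq_exp_add, convSeries_mul h]

theorem convExp_zero : convExp (0 : ConvHom 𝕜 H C) = 1 := by
  have h0 : IsPointwiseNilpotent (0 : ConvHom 𝕜 H C) := fun x => ⟨1, fun k hk => by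
    rw [zero_pow (by omega)]; rfl⟩
  refine ConvHom.ext_apply fun x => ?_
  rw [convExp, convSeries_apply h0 _ (n := 1) (fun k hk => by rw [zero_pow (by omega)]; rfl)]
  simp

theorem convExp_natCast_smul {ψ : ConvHom 𝕜 H C} (h : IsPointwiseNilpotent ψ) (n : ℕ) :
    convExp ((n : 𝕜) • ψ) = convExp ψ ^ n := by
  induction n with
  | zero => simp [convExp_zero]
  | succ n ih => rw [Nat.cast_succ, convExp_add_smul h, ih, one_smul, pow_succ]

theorem convExp_apply_one {ψ : ConvHom 𝕜 H C} (h : IsPointwiseNilpotent ψ) (h1 : ψ 1 = 0) :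
    convExp ψ 1 = 1 := by
  rw [convExp, convSeries_apply_one h h1]; simp

/-- The binomial coefficient `X.choose k` as a polynomial. -/
noncomputable def binomPoly (𝕜 : Type*) [RCLike 𝕜] (k : ℕ) : Polynomial 𝕜 :=
  Polynomial.C ((k.factorial : 𝕜)⁻¹) * descPochhammer 𝕜 k

theorem eval_binomPoly (n k : ℕ) : (binomPoly 𝕜 k).eval (n : 𝕜) = (n.choose k : 𝕜) := by
  rw [binomPoly, Polynomial.eval_mul, Polynomial.eval_C, descPochhammer_eval_eq_descFactorial,
    Nat.descFactorial_eq_factorial_mul_choose, Nat.cast_mul, inv_mul_cancel_left₀]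
  exact_mod_cast k.factorial_ne_zero

/-- The power series `log (1 + X)`; its coefficients are the linear coefficients of the binomial
polynomials. -/
noncomputable def logSeries (𝕜 : Type*) [RCLike 𝕜] : PowerSeries 𝕜 :=
  PowerSeries.mk fun k => (binomPoly 𝕜 k).coeff 1

theorem coeff_logSeries_zero : PowerSeries.coeff 0 (logSeries 𝕜) = 0 := by
  simp [logSeries, binomPoly, Polynomial.coeff_one]

theorem coeff_logSeries_one : PowerSeries.coeff 1 (logSeries 𝕜) = 1 := by
  simp [logSeries, binomPoly]

theorem coeff_logSeries_two : PowerSeries.coeff 2 (logSeries 𝕜) = -(2 : 𝕜)⁻¹ := by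
  have h : descPochhammer 𝕜 2 = Polynomial.X * (Polynomial.X - 1) := by
    rw [descPochhammer_succ_right]; simp
  rw [logSeries, PowerSeries.coeff_mk, binomPoly, Polynomial.coeff_C_mul, h,
    Polynomial.coeff_X_mul]
  simp [Polynomial.coeff_X, Polynomial.coeff_one]

/-- The logarithm of `φ`, for `φ - 1` pointwise nilpotent. -/
noncomputable def convLog (φ : ConvHom 𝕜 H C) : ConvHom 𝕜 H C := convSeries (logSeries 𝕜) (φ - 1)

/-- `C` need not be a domain, so counting roots fails over `C`. Linear functionals `C → 𝕜` separate
points, and applying one to all coefficients gives a polynomial over the field `𝕜` with infinitely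
many roots. -/
theorem Polynomial.ext_of_eval_natCast (𝕜 : Type*) [RCLike 𝕜] {C : Type*} [CommRing C]
    [Algebra 𝕜 C] {p q : Polynomial C} (h : ∀ n : ℕ, p.eval (n : C) = q.eval (n : C)) :
    p = q := by
  rw [← sub_eq_zero]
  set r := p - q with hr
  have hrn : ∀ n : ℕ, r.eval (n : C) = 0 := fun n => by
    rw [hr, Polynomial.eval_sub, h, sub_self]
  ext i
  rw [Polynomial.coeff_zero, ← Module.forall_dual_apply_eq_zero_iff 𝕜]
  intro f
  set s : Polynomial 𝕜 := ∑ j ∈ Finset.range (r.natDegree + 1),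
    Polynomial.monomial j (f (r.coeff j)) with hs
  have hs0 : s = 0 := by
    refine Polynomial.eq_zero_of_infinite_isRoot s ?_
    refine (Set.infinite_range_of_injective (Nat.cast_injective (R := 𝕜))).mono ?_
    rintro _ ⟨n, rfl⟩
    have h2 := congrArg f (hrn n)
    rw [Polynomial.eval_eq_sum_range, map_sum, map_zero] at h2
    rw [Set.mem_ofPred_eq, Polynomial.IsRoot, hs, Polynomial.eval_finsetSum, ← h2]
    refine Finset.sum_congr rfl fun j _ => ?_
    rw [Polynomial.eval_monomial]
    have : r.coeff j * (n : C) ^ j = ((n : 𝕜) ^ j) • r.coeff j := by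
      rw [Algebra.smul_def, map_pow, map_natCast, mul_comm]
    rw [this, map_smul, smul_eq_mul, mul_comm]
  have hc : s.coeff i = f (r.coeff i) := by
    rw [hs, Polynomial.finsetSum_coeff]
    simp only [Polynomial.coeff_monomial]
    rw [Finset.sum_ite_eq' ]
    split_ifs with hi
    · rfl
    · rw [Polynomial.coeff_eq_zero_of_natDegree_lt, map_zero]
      simpa using hi
  rw [← hc, hs0, Polynomial.coeff_zero]

/-- Expand `(1 + (φ - 1)) ^ n` and read each binomial coefficient as a polynomial in `n`. The linear
coefficient is the logarithm because the coefficients of `logSeries` were chosen as the linear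
coefficients of the binomial polynomials. -/
theorem exists_powPoly {φ : ConvHom 𝕜 H C} (h : IsPointwiseNilpotent (φ - 1)) (x : H) :
    ∃ p : Polynomial C, (∀ n : ℕ, p.eval (n : C) = (φ ^ n) x) ∧ p.coeff 1 = convLog φ x := by
  obtain ⟨M, hM⟩ := h x
  refine ⟨∑ k ∈ Finset.range M, (binomPoly 𝕜 k).map (algebraMap 𝕜 C) *
    Polynomial.C (((φ - 1) ^ k) x), fun n => ?_, ?_⟩
  -- Both cut-offs are harmless: beyond `n` the binomial coefficients vanish, and beyond `M` the
  -- powers of `φ - 1` vanish at `x`.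
  · have h1 : φ ^ n = ∑ k ∈ Finset.range (max M (n + 1)), (n.choose k) • (φ - 1) ^ k := by
      conv_lhs => rw [← sub_add_cancel φ 1, (Commute.one_right (φ - 1)).add_pow]
      rw [← Finset.sum_subset (Finset.range_subset_range.2 (le_max_right M (n + 1)))]
      · refine Finset.sum_congr rfl fun k _ => ?_
        rw [one_pow, mul_one, nsmul_eq_mul', ]
      · intro k _ hk
        rw [Nat.choose_eq_zero_of_lt, zero_smul]
        simpa using hk
    rw [h1, ConvHom.coe_sum, ← Finset.sum_subset
      (Finset.range_subset_range.2 (le_max_left M (n + 1)))]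
    · rw [Polynomial.eval_finsetSum]
      refine Finset.sum_congr rfl fun k _ => ?_
      rw [Polynomial.eval_mul, Polynomial.eval_C, ← map_natCast (algebraMap 𝕜 C),
        Polynomial.eval_map_apply, eval_binomPoly, map_natCast, ← nsmul_eq_mul]
      rfl
    · intro k _ hk
      have : ((φ - 1) ^ k) x = 0 := hM k (by simpa using hk)
      rw [WithConv.ofConv_smul, LinearMap.smul_apply, this, smul_zero]
  · rw [convLog, convSeries_apply h _ hM, Polynomial.finsetSum_coeff]
    refine Finset.sum_congr rfl fun k _ => ?_
    rw [Polynomial.coeff_mul_C, Polynomial.coeff_map, logSeries, PowerSeries.coeff_mk,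
      Algebra.smul_def]

theorem exists_expPoly {ψ : ConvHom 𝕜 H C} (h : IsPointwiseNilpotent ψ) (x : H) :
    ∃ p : Polynomial C, (∀ n : ℕ, p.coeff n = ((n.factorial : 𝕜)⁻¹) • (ψ ^ n) x) ∧
      ∀ t : 𝕜, p.eval (algebraMap 𝕜 C t) = convExp (t • ψ) x := by
  obtain ⟨M, hM⟩ := h x
  refine ⟨∑ k ∈ Finset.range M, Polynomial.monomial k (((k.factorial : 𝕜)⁻¹) • (ψ ^ k) x),
    fun n => ?_, fun t => ?_⟩
  · rw [Polynomial.finsetSum_coeff]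
    simp only [Polynomial.coeff_monomial]
    rw [Finset.sum_ite_eq']
    split_ifs with hn
    · rfl
    · rw [hM n (by simpa using hn), smul_zero]
  · rw [Polynomial.eval_finsetSum, convExp, ← convSeries_rescale h, convSeries_apply h _ hM]
    refine Finset.sum_congr rfl fun k _ => ?_
    rw [Polynomial.eval_monomial, PowerSeries.coeff_rescale, coeff_exp_eq, mul_comm, ← map_pow,
      ← Algebra.smul_def, smul_smul]

/-- Since `exp (n ψ) = (exp ψ) ^ n`, the polynomials of `exists_expPoly` and `exists_powPoly` agree
at all natural numbers. Their linear coefficients are the two sides. -/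
theorem convLog_convExp {ψ : ConvHom 𝕜 H C} (h : IsPointwiseNilpotent ψ)
    (h' : IsPointwiseNilpotent (convExp ψ - 1)) : convLog (convExp ψ) = ψ := by
  refine ConvHom.ext_apply fun x => ?_
  obtain ⟨p, hp, hp1⟩ := exists_powPoly h' x
  obtain ⟨q, hq1, hq⟩ := exists_expPoly h x
  have hpq : p = q := by
    refine Polynomial.ext_of_eval_natCast 𝕜 fun n => ?_
    rw [hp, ← convExp_natCast_smul h, ← hq, map_natCast]
  rw [← hp1, hpq, hq1]
  simp

/-- The polynomials `P x` interpolating `n ↦ (φ ^ n) x` satisfy the differential equation of the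
one-parameter group generated by `log φ`. Solving it coefficientwise identifies `P x` with `t ↦ exp
(t log φ) x`; then set `t = 1`. -/
theorem convExp_convLog {φ : ConvHom 𝕜 H C} (h : IsPointwiseNilpotent (φ - 1))
    (h' : IsPointwiseNilpotent (convLog φ)) : convExp (convLog φ) = φ := by
  choose P hP hP1 using exists_powPoly h
  have hder : ∀ x : H, Polynomial.derivative (P x) =
      ∑ i ∈ (Coalgebra.Repr.arbitrary 𝕜 x).index,
        Polynomial.C (convLog φ ((Coalgebra.Repr.arbitrary 𝕜 x).left i)) *
          P ((Coalgebra.Repr.arbitrary 𝕜 x).right i) := by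
    intro x
    set r := Coalgebra.Repr.arbitrary 𝕜 x
    refine Polynomial.ext_of_eval_natCast 𝕜 fun n => ?_
    -- The law `φ ^ (m + n) = φ ^ m * φ ^ n`, as a polynomial identity in `m` for fixed `n`. Its
    -- linear coefficient in `m` is the derivative of `P x` at `n`.
    have key : Polynomial.taylor (n : C) (P x) =
        ∑ i ∈ r.index, P (r.left i) * Polynomial.C ((P (r.right i)).eval (n : C)) := by
      refine Polynomial.ext_of_eval_natCast 𝕜 fun m => ?_
      rw [Polynomial.taylor_eval, ← Nat.cast_add, hP, pow_add, r.convMul_apply,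
        Polynomial.eval_finsetSum]
      simp only [Polynomial.eval_mul, Polynomial.eval_C, hP]
    rw [← Polynomial.taylor_coeff_one, key, Polynomial.finsetSum_coeff, Polynomial.eval_finsetSum]
    simp only [Polynomial.coeff_mul_C, hP1, Polynomial.eval_mul, Polynomial.eval_C]
  -- The differential equation as a recursion for the coefficients; it starts from `P x` at `0`,
  -- which is the counit.
  have hcoeff : ∀ (k : ℕ) (x : H),
      (P x).coeff k = ((k.factorial : 𝕜)⁻¹) • (convLog φ ^ k) x := by
    intro k
    induction k with
    | zero =>
      intro x
      rw [Polynomial.coeff_zero_eq_eval_zero]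
      have := hP x 0
      rw [Nat.cast_zero] at this
      rw [this]
      simp
    | succ k ih =>
      intro x
      have h1 := congrArg (fun p => Polynomial.coeff p k) (hder x)
      simp only [Polynomial.coeff_derivative, Polynomial.finsetSum_coeff,
        Polynomial.coeff_C_mul, ih] at h1
      have h2 : ((k : 𝕜) + 1) • (P x).coeff (k + 1) =
          ((k.factorial : 𝕜)⁻¹) • (convLog φ ^ (k + 1)) x := by
        rw [Algebra.smul_def, map_add, map_natCast, map_one, mul_comm, h1, pow_succ',
          ConvHom.mul_apply_repr, Finset.smul_sum]
        simp only [mul_smul_comm]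
      have h3 : ((k : 𝕜) + 1) ≠ 0 := by exact_mod_cast k.succ_ne_zero
      rw [← inv_smul_smul₀ h3 ((P x).coeff (k + 1)), h2, smul_smul, Nat.factorial_succ,
        Nat.cast_mul, Nat.cast_succ, mul_inv]
  refine ConvHom.ext_apply fun x => ?_
  obtain ⟨q, hq, hq1⟩ := exists_expPoly h' x
  have hpq : P x = q := Polynomial.ext fun n => by rw [hcoeff, hq]
  have h1 := hP x 1
  have h2 := hq1 1
  rw [map_one, one_smul, ← hpq] at h2
  rw [Nat.cast_one, pow_one] at h1
  rw [← h2, h1]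

end ConvolutionSeries

/-! ### Characters, infinitesimal characters and conilpotency -/

section Characters

variable {𝕜 : Type*} [RCLike 𝕜] {H : Type*} [Ring H] [HopfAlgebra 𝕜 H]
variable {C : Type*} [CommRing C] [Algebra 𝕜 C]

/-- Infinitesimal characters, as elements of the convolution algebra. -/
def IsInfinitesimalChar (ψ : ConvHom 𝕜 H C) : Prop :=
  ∀ a b : H, ψ (a * b) = Coalgebra.counit (R := 𝕜) b • ψ a + Coalgebra.counit (R := 𝕜) a • ψ b

/-- Characters, as elements of the convolution algebra. -/
structure IsConvChar (φ : ConvHom 𝕜 H C) : Prop where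
  map_one : φ 1 = 1
  map_mul : ∀ a b : H, φ (a * b) = φ a * φ b

theorem IsInfinitesimalChar.map_one {ψ : ConvHom 𝕜 H C} (h : IsInfinitesimalChar ψ) :
    ψ 1 = 0 := by
  have := h 1 1
  simpa using this

theorem CharGroup.isConvChar_toHom (φ : CharGroup 𝕜 H C) : IsConvChar φ.toHom :=
  ⟨map_one φ.ofConv, map_mul φ.ofConv⟩

/-- The character with the given underlying linear map. -/
noncomputable def IsConvChar.toCharGroup {φ : ConvHom 𝕜 H C} (h : IsConvChar φ) :
    CharGroup 𝕜 H C :=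
  WithConv.toConv (AlgHom.ofLinearMap φ.ofConv h.map_one h.map_mul)

theorem IsConvChar.toHom_toCharGroup {φ : ConvHom 𝕜 H C} (h : IsConvChar φ) :
    h.toCharGroup.toHom = φ := rfl

theorem IsConvChar.mul {φ χ : ConvHom 𝕜 H C} (hφ : IsConvChar φ) (hχ : IsConvChar χ) :
    IsConvChar (φ * χ) := by
  rw [← hφ.toHom_toCharGroup, ← hχ.toHom_toCharGroup, ← CharGroup.toHom_mul]
  exact CharGroup.isConvChar_toHom _

theorem IsConvChar.one : IsConvChar (1 : ConvHom 𝕜 H C) := by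
  rw [← CharGroup.toHom_one]
  exact CharGroup.isConvChar_toHom _

theorem IsConvChar.pow {φ : ConvHom 𝕜 H C} (hφ : IsConvChar φ) (n : ℕ) : IsConvChar (φ ^ n) := by
  induction n with
  | zero => rw [pow_zero]; exact .one
  | succ n ih => rw [pow_succ]; exact ih.mul hφ

/-- Every `φ ^ n` is a character, so the interpolating polynomial at `a * b` is the product of those
at `a` and `b`. The linear coefficient of a product obeys the Leibniz rule, and the constant
coefficients are the counits. -/
theorem IsConvChar.isInfinitesimalChar_convLog {φ : ConvHom 𝕜 H C} (hφ : IsConvChar φ)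
    (h : IsPointwiseNilpotent (φ - 1)) : IsInfinitesimalChar (convLog φ) := by
  intro a b
  obtain ⟨p, hp, hp1⟩ := exists_powPoly h a
  obtain ⟨q, hq, hq1⟩ := exists_powPoly h b
  obtain ⟨r, hr, hr1⟩ := exists_powPoly h (a * b)
  have hrpq : r = p * q := Polynomial.ext_of_eval_natCast 𝕜 fun n => by
    rw [Polynomial.eval_mul, hp, hq, hr, (hφ.pow n).map_mul]
  have hp0 : p.coeff 0 = algebraMap 𝕜 C (Coalgebra.counit (R := 𝕜) a) := by
    have := hp 0
    rw [Nat.cast_zero, ← Polynomial.coeff_zero_eq_eval_zero] at this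
    rw [this, pow_zero, LinearMap.convOne_apply]
  have hq0 : q.coeff 0 = algebraMap 𝕜 C (Coalgebra.counit (R := 𝕜) b) := by
    have := hq 0
    rw [Nat.cast_zero, ← Polynomial.coeff_zero_eq_eval_zero] at this
    rw [this, pow_zero, LinearMap.convOne_apply]
  rw [← hr1, hrpq, Polynomial.mul_coeff_one, hp0, hq0, hp1, hq1, Algebra.smul_def,
    Algebra.smul_def, add_comm, mul_comm (convLog φ a)]

/-- The linear map `a ⊗ b ↦ φ a * χ b`. -/
noncomputable def convTensor (φ χ : ConvHom 𝕜 H C) : WithConv (H ⊗[𝕜] H →ₗ[𝕜] C) :=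
  WithConv.toConv (LinearMap.mul' 𝕜 C ∘ₗ TensorProduct.map φ.ofConv χ.ofConv)

theorem convTensor_tmul (φ χ : ConvHom 𝕜 H C) (a b : H) :
    convTensor φ χ (a ⊗ₜ b) = φ a * χ b := rfl

theorem convTensor_mul (φ χ φ' χ' : ConvHom 𝕜 H C) :
    convTensor φ χ * convTensor φ' χ' = convTensor (φ * φ') (χ * χ') := by
  have h := LinearMap.algHom_comp_convMul_distrib (Algebra.TensorProduct.lmul' 𝕜 (S := C))
    (WithConv.toConv (TensorProduct.map φ.ofConv χ.ofConv))
    (WithConv.toConv (TensorProduct.map φ'.ofConv χ'.ofConv))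
  rw [TensorProduct.map_convMul_map] at h
  exact (WithConv.ofConv_injective h).symm

theorem convTensor_one : convTensor (1 : ConvHom 𝕜 H C) 1 = 1 := by
  refine WithConv.ext (TensorProduct.ext' fun a b => ?_)
  rw [convTensor_tmul, LinearMap.convOne_apply, LinearMap.convOne_apply,
    LinearMap.convOne_apply]
  simp [mul_comm]

theorem convTensor_pow (φ χ : ConvHom 𝕜 H C) (n : ℕ) :
    convTensor φ χ ^ n = convTensor (φ ^ n) (χ ^ n) := by
  induction n with
  | zero => simp only [pow_zero, convTensor_one]
  | succ n ih => rw [pow_succ, ih, convTensor_mul, pow_succ, pow_succ]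

/-- Composition with the multiplication of `H`. -/
noncomputable def convPullbackMul (φ : ConvHom 𝕜 H C) : WithConv (H ⊗[𝕜] H →ₗ[𝕜] C) :=
  WithConv.toConv (φ.ofConv ∘ₗ (Bialgebra.mulCoalgHom 𝕜 H).toLinearMap)

theorem convPullbackMul_tmul (φ : ConvHom 𝕜 H C) (a b : H) :
    convPullbackMul φ (a ⊗ₜ b) = φ (a * b) := rfl

/-- The multiplication `H ⊗ H → H` is a morphism of coalgebras, so composing with it respects
convolution. -/
theorem convPullbackMul_mul (φ χ : ConvHom 𝕜 H C) :
    convPullbackMul (φ * χ) = convPullbackMul φ * convPullbackMul χ :=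
  WithConv.ofConv_injective
    (LinearMap.convMul_comp_coalgHom_distrib φ χ (Bialgebra.mulCoalgHom 𝕜 H))

theorem convPullbackMul_pow (φ : ConvHom 𝕜 H C) (n : ℕ) :
    convPullbackMul (φ ^ n) = convPullbackMul φ ^ n := by
  induction n with
  | zero =>
    rw [pow_zero, pow_zero]
    refine WithConv.ext (TensorProduct.ext' fun a b => ?_)
    rw [convPullbackMul_tmul, LinearMap.convOne_apply, LinearMap.convOne_apply]
    simp [mul_comm]
  | succ n ih => rw [pow_succ, convPullbackMul_mul, ih, pow_succ]

/-- In the convolution algebra of `H ⊗ H`, the pullback of `ψ` is the sum of the commuting elements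
`convTensor ψ 1` and `convTensor 1 ψ`; the binomial theorem applies. -/
theorem IsInfinitesimalChar.pow_apply_mul {ψ : ConvHom 𝕜 H C} (h : IsInfinitesimalChar ψ) (n : ℕ)
    (a b : H) : (ψ ^ n) (a * b) = ∑ m ∈ Finset.HasAntidiagonal.antidiagonal n,
      n.choose m.1 • ((ψ ^ m.1) a * (ψ ^ m.2) b) := by
  have h1 : convPullbackMul ψ = convTensor ψ 1 + convTensor 1 ψ := by
    refine WithConv.ext (TensorProduct.ext' fun a b => ?_)
    rw [convPullbackMul_tmul, h a b, WithConv.ofConv_add, LinearMap.add_apply, convTensor_tmul,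
      convTensor_tmul, LinearMap.convOne_apply, LinearMap.convOne_apply, Algebra.smul_def,
      Algebra.smul_def, mul_comm (ψ a)]
  have hc : Commute (convTensor ψ 1) (convTensor 1 ψ) := by
    rw [Commute, SemiconjBy, convTensor_mul, convTensor_mul, one_mul, mul_one]
  rw [← convPullbackMul_tmul, convPullbackMul_pow, h1, hc.add_pow', WithConv.ofConv_sum,
    LinearMap.sum_apply]
  refine Finset.sum_congr rfl fun m _ => ?_
  rw [convTensor_pow, convTensor_pow, convTensor_mul, one_pow, one_pow, one_mul, mul_one]
  rw [WithConv.ofConv_smul, LinearMap.smul_apply, convTensor_tmul]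

theorem IsInfinitesimalChar.isConvChar_convExp {ψ : ConvHom 𝕜 H C} (hψ : IsInfinitesimalChar ψ)
    (h : IsPointwiseNilpotent ψ) : IsConvChar (convExp ψ) := by
  refine ⟨convExp_apply_one h hψ.map_one, fun a b => ?_⟩
  obtain ⟨p, hp, hp1⟩ := exists_expPoly h a
  obtain ⟨q, hq, hq1⟩ := exists_expPoly h b
  obtain ⟨r, hr, hr1⟩ := exists_expPoly h (a * b)
  have hrpq : r = p * q := Polynomial.ext fun n => by
    rw [Polynomial.coeff_mul, hr, hψ.pow_apply_mul, Finset.smul_sum]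
    refine Finset.sum_congr rfl fun m hm => ?_
    rw [hp, hq, smul_mul_smul_comm, ← Nat.cast_smul_eq_nsmul 𝕜, smul_smul]
    congr 1
    rw [Finset.HasAntidiagonal.mem_antidiagonal] at hm
    rw [← hm, Nat.cast_add_choose]
    have h0 : ((m.1 + m.2).factorial : 𝕜) ≠ 0 := by exact_mod_cast Nat.factorial_ne_zero _
    have h1 : (m.1.factorial : 𝕜) ≠ 0 := by exact_mod_cast Nat.factorial_ne_zero _
    have h2 : (m.2.factorial : 𝕜) ≠ 0 := by exact_mod_cast Nat.factorial_ne_zero _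
    field_simp
  have e1 := hp1 1
  have e2 := hq1 1
  have e3 := hr1 1
  rw [one_smul] at e1 e2 e3
  rw [← e1, ← e2, ← e3, hrpq, Polynomial.eval_mul]

/-- At a given element, all high enough convolution powers of linear maps vanishing at `1` vanish,
uniformly in the linear map and in the target algebra. -/
def IsConilpotent.{w, u, v} (𝕜 : Type u) [RCLike 𝕜] (H : Type v) [Ring H] [HopfAlgebra 𝕜 H] :
    Prop :=
  ∀ x : H, ∃ n : ℕ, ∀ (C : Type w) [CommRing C] [Algebra 𝕜 C] (χ : ConvHom 𝕜 H C),
    χ 1 = 0 → ∀ k, n ≤ k → (χ ^ k) x = 0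

theorem IsConilpotent.isPointwiseNilpotent.{w, u, v} {𝕜 : Type u} [RCLike 𝕜] {H : Type v} [Ring H]
    [HopfAlgebra 𝕜 H] {C : Type w} [CommRing C] [Algebra 𝕜 C] (hH : IsConilpotent.{w} 𝕜 H)
    {χ : ConvHom 𝕜 H C} (h : χ 1 = 0) : IsPointwiseNilpotent χ := fun x =>
  (hH x).imp fun _ hn => hn C χ h

/-- The grading axioms do not include this. Comparing the components of degree `m` in `a = a * 1`,
for `a` of degree `m`, shows that the degree-zero part `e` of `1` is a right identity, so `e = 1`.
-/
theorem IsConnectedHopfGrading.one_mem {𝒢 : ℕ → Submodule 𝕜 H} (h : IsConnectedHopfGrading 𝕜 𝒢) :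
    (1 : H) ∈ 𝒢 0 := by
  classical
  let _ := h.internal.chooseDecomposition
  set e : H := (DirectSum.decompose 𝒢 (1 : H) 0 : H) with he
  have he0 : e ∈ 𝒢 0 := SetLike.coe_mem _
  have key : ∀ m, ∀ a ∈ 𝒢 m, a * e = a := by
    intro m a ha
    have h1 : a = ∑ i ∈ (DirectSum.decompose 𝒢 (1 : H)).support,
        a * (DirectSum.decompose 𝒢 (1 : H) i : H) := by
      conv_lhs => rw [← mul_one a, ← DirectSum.sum_support_decompose 𝒢 (1 : H), Finset.mul_sum]
    have h2 := congrArg (fun y => (DirectSum.decompose 𝒢 y m : H)) h1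
    simp only [DirectSum.decompose_sum, DirectSum.sum_apply, AddSubmonoidClass.coe_finsetSum,
      DirectSum.decompose_of_mem_same 𝒢 ha] at h2
    rw [Finset.sum_eq_single 0] at h2
    · rw [DirectSum.decompose_of_mem_same 𝒢 (i := m)] at h2
      · exact h2.symm
      · simpa using h.mul_mem m 0 a ha _ he0
    · intro i _ hi
      rw [DirectSum.decompose_of_mem_ne 𝒢 (h.mul_mem m i a ha _ (SetLike.coe_mem _)) (by omega)]
    · intro h0
      rw [DFinsupp.notMem_support_iff] at h0
      rw [h0, ZeroMemClass.coe_zero, mul_zero, DirectSum.decompose_zero]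
      rfl
  have key' : ∀ a : H, a * e = a := by
    intro a
    conv_lhs => rw [← DirectSum.sum_support_decompose 𝒢 a, Finset.sum_mul]
    conv_rhs => rw [← DirectSum.sum_support_decompose 𝒢 a]
    exact Finset.sum_congr rfl fun i _ => key i _ (SetLike.coe_mem _)
  rw [← key' 1, one_mul]
  exact he0

theorem IsConnectedHopfGrading.exists_smul_one_eq {𝒢 : ℕ → Submodule 𝕜 H}
    (h : IsConnectedHopfGrading 𝕜 𝒢) {x : H} (hx : x ∈ 𝒢 0) : ∃ c : 𝕜, c • (1 : H) = x := by
  obtain ⟨e⟩ := h.connected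
  have h1 : e ⟨1, h.one_mem⟩ ≠ 0 := by
    intro h0
    have h2 : (⟨1, h.one_mem⟩ : 𝒢 0) = 0 := by simpa using h0
    have h3 := congrArg (Coalgebra.counit (R := 𝕜)) (congrArg Subtype.val h2)
    simp at h3
  refine ⟨e ⟨x, hx⟩ * (e ⟨1, h.one_mem⟩)⁻¹, ?_⟩
  have h4 : (e ⟨x, hx⟩ * (e ⟨1, h.one_mem⟩)⁻¹) • (⟨1, h.one_mem⟩ : 𝒢 0) = ⟨x, hx⟩ := by
    apply e.injective
    rw [map_smul, smul_eq_mul, inv_mul_cancel_right₀ h1]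
  exact congrArg Subtype.val h4

/-- Orders of vanishing add under convolution: if `k + l < p + q`, then `k < p` or `l < q`, so one
factor kills each term of `Δ x`. -/
theorem IsConnectedHopfGrading.mul_apply_eq_zero {𝒢 : ℕ → Submodule 𝕜 H}
    (h : IsConnectedHopfGrading 𝕜 𝒢) {φ χ : ConvHom 𝕜 H C} {p q : ℕ}
    (hφ : ∀ m < p, ∀ x ∈ 𝒢 m, φ x = 0) (hχ : ∀ m < q, ∀ x ∈ 𝒢 m, χ x = 0) :
    ∀ m < p + q, ∀ x ∈ 𝒢 m, (φ * χ) x = 0 := by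
  intro m hm x hx
  rw [LinearMap.convMul_apply]
  suffices hle : (⨆ (k : ℕ) (l : ℕ) (_ : k + l = m),
      LinearMap.range (TensorProduct.map (𝒢 k).subtype (𝒢 l).subtype)) ≤
      LinearMap.ker (LinearMap.mul' 𝕜 C ∘ₗ TensorProduct.map φ.ofConv χ.ofConv) from
    LinearMap.mem_ker.1 (hle (h.comul_mem m x hx))
  refine iSup_le fun k => iSup_le fun l => iSup_le fun hkl => ?_
  rw [LinearMap.range_le_ker_iff]
  refine TensorProduct.ext' fun y z => ?_
  have : φ (y : H) * χ (z : H) = 0 := by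
    rcases lt_or_ge k p with hk | hk
    · rw [hφ k hk y y.2, zero_mul]
    · rw [hχ l (by omega) z z.2, mul_zero]
  exact this

/-- The condition `χ 1 = 0` says that `χ` vanishes in degree `0`, so `χ ^ k` vanishes in degrees
below `k`. The bound at `x` depends only on the degrees of the components of `x`. -/
theorem IsConnectedHopfGrading.isConilpotent.{w} {𝒢 : ℕ → Submodule 𝕜 H}
    (h : IsConnectedHopfGrading 𝕜 𝒢) : IsConilpotent.{w} 𝕜 H := by
  have hpow : ∀ (C : Type w) [CommRing C] [Algebra 𝕜 C] (χ : ConvHom 𝕜 H C), χ 1 = 0 →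
      ∀ k, ∀ m < k, ∀ x ∈ 𝒢 m, (χ ^ k) x = 0 := by
    intro C _ _ χ hχ k
    induction k with
    | zero => intro m hm; omega
    | succ k ih =>
      rw [pow_succ]
      refine h.mul_apply_eq_zero ih fun m hm x hx => ?_
      obtain rfl : m = 0 := by omega
      obtain ⟨c, rfl⟩ := h.exists_smul_one_eq hx
      rw [map_smul, hχ, smul_zero]
  intro x
  have hx : x ∈ ⨆ m, 𝒢 m := by
    rw [h.internal.submodule_iSup_eq_top]; trivial
  refine Submodule.iSup_induction 𝒢 (motive := fun x => ∃ n : ℕ, ∀ (C : Type w) [CommRing C]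
    [Algebra 𝕜 C] (χ : ConvHom 𝕜 H C), χ 1 = 0 → ∀ k, n ≤ k → (χ ^ k) x = 0) hx ?_ ?_ ?_
  · exact fun m x hx => ⟨m + 1, fun C _ _ χ hχ k hk => hpow C χ hχ k m (by omega) x hx⟩
  · exact ⟨0, fun C _ _ χ hχ k hk => map_zero _⟩
  · rintro x y ⟨n, hn⟩ ⟨n', hn'⟩
    refine ⟨max n n', fun C _ _ χ hχ k hk => ?_⟩
    rw [map_add, hn C χ hχ k (le_of_max_le_left hk), hn' C χ hχ k (le_of_max_le_right hk),
      add_zero]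

end Characters

/-! ### Exponential and logarithm relative to an annihilator -/

section Annihilators

universe w u v

variable {𝕜 : Type u} [RCLike 𝕜] {H : Type v} [Ring H] [HopfAlgebra 𝕜 H]
variable {C : Type w} [CommRing C] [Algebra 𝕜 C]

/-- The linear maps vanishing on `J` are closed under convolution. -/
def AnnIsConvClosed.{w', u', v'} (𝕜 : Type u') [RCLike 𝕜] {H : Type v'} [Ring H] [HopfAlgebra 𝕜 H]
    (J : Set H) : Prop :=
  ∀ (C : Type w') [CommRing C] [Algebra 𝕜 C] (φ χ : ConvHom 𝕜 H C),
    (∀ x ∈ J, φ x = 0) → (∀ x ∈ J, χ x = 0) → ∀ x ∈ J, (φ * χ) x = 0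

variable (J : Set H)

/-- Infinitesimal characters vanishing on `J`. -/
structure IsAnnInfChar (ψ : ConvHom 𝕜 H C) : Prop where
  isInfinitesimalChar : IsInfinitesimalChar ψ
  ann : ∀ x ∈ J, ψ x = 0

/-- Characters which agree with the counit on `J`. -/
structure IsAnnChar (φ : ConvHom 𝕜 H C) : Prop where
  isConvChar : IsConvChar φ
  ann : ∀ x ∈ J, (φ - 1) x = 0

variable {J}

/-- Positive powers of `χ` vanish on `J`. The zeroth power is the counit, about which nothing is
assumed on `J` here; hence the condition on the constant coefficient. -/
theorem AnnIsConvClosed.convSeries_apply (hJ : AnnIsConvClosed.{w} 𝕜 J) {χ : ConvHom 𝕜 H C}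
    (h : IsPointwiseNilpotent χ) (hχ : ∀ x ∈ J, χ x = 0) {f : PowerSeries 𝕜}
    (hf : PowerSeries.coeff 0 f = 0) : ∀ x ∈ J, convSeries f χ x = 0 := by
  intro x hx
  have hpow : ∀ k, ∀ x ∈ J, (χ ^ (k + 1)) x = 0 := by
    intro k
    induction k with
    | zero => simpa using hχ
    | succ k ih => rw [pow_succ]; exact hJ C _ _ ih hχ
  obtain ⟨n, hn⟩ := h x
  rw [_root_.convSeries_apply h f hn]
  refine Finset.sum_eq_zero fun k _ => ?_
  cases k with
  | zero => rw [hf, zero_smul]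
  | succ k => rw [hpow k x hx, smul_zero]

theorem convSeries_sub_one {χ : ConvHom 𝕜 H C} (h : IsPointwiseNilpotent χ) (f : PowerSeries 𝕜) :
    convSeries (f - 1) χ = convSeries f χ - 1 := by
  rw [← convSeries_one h]
  refine ConvHom.ext_apply fun x => ?_
  obtain ⟨n, hn⟩ := h x
  rw [WithConv.ofConv_sub, LinearMap.sub_apply]
  simp only [convSeries_apply h _ hn, map_sub, sub_smul, Finset.sum_sub_distrib]

variable (hH : IsConilpotent.{w} 𝕜 H)
include hH

theorem IsAnnInfChar.isPointwiseNilpotent {ψ : ConvHom 𝕜 H C} (hψ : IsAnnInfChar J ψ) :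
    IsPointwiseNilpotent ψ := hH.isPointwiseNilpotent hψ.isInfinitesimalChar.map_one

theorem IsConvChar.isPointwiseNilpotent {φ : ConvHom 𝕜 H C} (hφ : IsConvChar φ) :
    IsPointwiseNilpotent (φ - 1) := hH.isPointwiseNilpotent (by simp [hφ.map_one])

theorem IsAnnInfChar.isAnnChar_convExp (hJ : AnnIsConvClosed.{w} 𝕜 J) {ψ : ConvHom 𝕜 H C}
    (hψ : IsAnnInfChar J ψ) : IsAnnChar J (convExp ψ) := by
  have h := hψ.isPointwiseNilpotent hH
  refine ⟨hψ.isInfinitesimalChar.isConvChar_convExp h, ?_⟩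
  rw [convExp, ← convSeries_sub_one h]
  exact hJ.convSeries_apply h hψ.ann (by simp)

theorem IsAnnChar.isAnnInfChar_convLog (hJ : AnnIsConvClosed.{w} 𝕜 J) {φ : ConvHom 𝕜 H C}
    (hφ : IsAnnChar J φ) : IsAnnInfChar J (convLog φ) := by
  have h := hφ.isConvChar.isPointwiseNilpotent hH
  exact ⟨hφ.isConvChar.isInfinitesimalChar_convLog h,
    hJ.convSeries_apply h hφ.ann coeff_logSeries_zero⟩

omit hH in
theorem IsAnnChar.mul (hJ : AnnIsConvClosed.{w} 𝕜 J) {φ χ : ConvHom 𝕜 H C}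
    (hφ : IsAnnChar J φ) (hχ : IsAnnChar J χ) : IsAnnChar J (φ * χ) := by
  refine ⟨hφ.isConvChar.mul hχ.isConvChar, fun x hx => ?_⟩
  have h : φ * χ - 1 = (φ - 1) * (χ - 1) + (φ - 1) + (χ - 1) := by noncomm_ring
  rw [h, WithConv.ofConv_add, WithConv.ofConv_add, LinearMap.add_apply, LinearMap.add_apply,
    hJ C _ _ hφ.ann hχ.ann x hx, hφ.ann x hx, hχ.ann x hx, add_zero, add_zero]

theorem IsConvChar.convExp_convLog {φ : ConvHom 𝕜 H C} (hφ : IsConvChar φ) :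
    convExp (convLog φ) = φ := by
  have h := hφ.isPointwiseNilpotent hH
  exact _root_.convExp_convLog h
    (hH.isPointwiseNilpotent (hφ.isInfinitesimalChar_convLog h).map_one)

theorem IsAnnInfChar.convLog_convExp {ψ : ConvHom 𝕜 H C} (hψ : IsAnnInfChar J ψ) :
    convLog (convExp ψ) = ψ := by
  have h := hψ.isPointwiseNilpotent hH
  exact _root_.convLog_convExp h
    ((hψ.isInfinitesimalChar.isConvChar_convExp h).isPointwiseNilpotent hH)

omit hH in
/-- The Baker-Campbell-Hausdorff multiplication `log (exp ψ * exp χ)`. -/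
noncomputable def convBCH (ψ χ : ConvHom 𝕜 H C) : ConvHom 𝕜 H C := convLog (convExp ψ * convExp χ)

theorem IsAnnInfChar.convBCH (hJ : AnnIsConvClosed.{w} 𝕜 J) {ψ χ : ConvHom 𝕜 H C}
    (hψ : IsAnnInfChar J ψ) (hχ : IsAnnInfChar J χ) : IsAnnInfChar J (convBCH ψ χ) :=
  ((hψ.isAnnChar_convExp hH hJ).mul hJ (hχ.isAnnChar_convExp hH hJ)).isAnnInfChar_convLog hH hJ

end Annihilators

/-! ### Naturality in the target algebra -/

section Naturality

variable {𝕜 : Type*} [RCLike 𝕜] {H : Type*} [Ring H] [HopfAlgebra 𝕜 H]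
variable {B : Type*} [CommRing B] [Algebra 𝕜 B] {C : Type*} [CommRing C] [Algebra 𝕜 C]

/-- Composition with an algebra homomorphism, as a homomorphism of convolution algebras. -/
noncomputable def convPushforward (j : B →ₐ[𝕜] C) : ConvHom 𝕜 H B →+* ConvHom 𝕜 H C where
  toFun φ := WithConv.toConv (j.toLinearMap ∘ₗ φ.ofConv)
  map_one' := ConvHom.ext_apply fun _ => j.commutes _
  map_mul' φ χ := WithConv.ofConv_injective (LinearMap.algHom_comp_convMul_distrib j φ χ)
  map_zero' := ConvHom.ext_apply fun _ => map_zero j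
  map_add' _ _ := ConvHom.ext_apply fun _ => map_add j _ _

theorem convPushforward_apply (j : B →ₐ[𝕜] C) (φ : ConvHom 𝕜 H B) (x : H) :
    convPushforward j φ x = j (φ x) := rfl

theorem convPushforward_convSeries (j : B →ₐ[𝕜] C) {χ : ConvHom 𝕜 H B}
    (h : IsPointwiseNilpotent χ) (f : PowerSeries 𝕜) :
    convPushforward j (convSeries f χ) = convSeries f (convPushforward j χ) := by
  have hn' : ∀ {x : H} {n : ℕ}, (∀ k, n ≤ k → (χ ^ k) x = 0) →
      ∀ k, n ≤ k → (convPushforward j χ ^ k) x = 0 := fun hn k hk => by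
    rw [← map_pow, convPushforward_apply, hn k hk, map_zero]
  have h' : IsPointwiseNilpotent (convPushforward j χ) := fun x => (h x).imp fun n hn => hn' hn
  refine ConvHom.ext_apply fun x => ?_
  obtain ⟨n, hn⟩ := h x
  rw [convPushforward_apply, convSeries_apply h f hn, convSeries_apply h' f (hn' hn), map_sum]
  refine Finset.sum_congr rfl fun k _ => ?_
  rw [map_smul, ← map_pow, convPushforward_apply]

/-- Used for the inclusion of `B` into its complexification: it shows that the complex
multiplication formula extends the original one. -/
theorem convPushforward_convBCH (j : B →ₐ[𝕜] C) {ψ χ : ConvHom 𝕜 H B}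
    (hψ : IsPointwiseNilpotent ψ) (hχ : IsPointwiseNilpotent χ)
    (h : IsPointwiseNilpotent (convExp ψ * convExp χ - 1)) :
    convPushforward j (convBCH ψ χ) = convBCH (convPushforward j ψ) (convPushforward j χ) := by
  rw [convBCH, convLog, convPushforward_convSeries j h, map_sub, map_mul, map_one, convExp,
    convExp, convPushforward_convSeries j hψ, convPushforward_convSeries j hχ]
  rfl

end Naturality

/-! ### Evaluations of convolution expressions in rings of functions -/

section FunctionRings

universe w u v

variable {𝕜 : Type u} [RCLike 𝕜] {H : Type v} [Ring H] [HopfAlgebra 𝕜 H]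
variable {C : Type w} [CommRing C] [Algebra 𝕜 C] {X : Type*}

/-- All evaluations of the map `F` belong to the ring `S` of functions. -/
def EvalMem (S : Subring (X → C)) (F : X → ConvHom 𝕜 H C) : Prop :=
  ∀ x : H, (fun z => F z x) ∈ S

variable {S : Subring (X → C)} {F F' : X → ConvHom 𝕜 H C}

theorem EvalMem.mul (h : EvalMem S F) (h' : EvalMem S F') : EvalMem S fun z => F z * F' z := by
  intro x
  have : (fun z => (F z * F' z) x) = ∑ i ∈ (Coalgebra.Repr.arbitrary 𝕜 x).index,
      (fun z => F z ((Coalgebra.Repr.arbitrary 𝕜 x).left i)) *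
        (fun z => F' z ((Coalgebra.Repr.arbitrary 𝕜 x).right i)) := by
    funext z
    rw [ConvHom.mul_apply_repr, Finset.sum_apply]
    rfl
  rw [this]
  exact sum_mem fun i _ => mul_mem (h _) (h' _)

theorem EvalMem.sub (h : EvalMem S F) (h' : EvalMem S F') : EvalMem S fun z => F z - F' z :=
  fun x => sub_mem (h x) (h' x)

variable (hS : ∀ c : C, (fun _ => c) ∈ S)
include hS

theorem evalMem_const (φ : ConvHom 𝕜 H C) : EvalMem S fun _ => φ := fun x => hS (φ x)

theorem EvalMem.pow (h : EvalMem S F) (n : ℕ) : EvalMem S fun z => F z ^ n := by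
  induction n with
  | zero => simpa only [pow_zero] using evalMem_const hS 1
  | succ n ih => simpa only [pow_succ] using ih.mul h

variable (hH : IsConilpotent.{w} 𝕜 H)
include hH

/-- The bound `n` at `x` does not depend on `z`, so a single finite sum represents the series for
all `z` at once. This is applied to rings of continuous functions and to `polyMaps`. -/
theorem EvalMem.convSeries (h : EvalMem S F) (h1 : ∀ z, F z 1 = 0) (f : PowerSeries 𝕜) :
    EvalMem S fun z => convSeries f (F z) := by
  intro x
  obtain ⟨n, hn⟩ := hH x
  have : (fun z => _root_.convSeries f (F z) x) = ∑ k ∈ Finset.range n,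
      (fun _ => algebraMap 𝕜 C (PowerSeries.coeff k f)) * (fun z => (F z ^ k) x) := by
    funext z
    rw [convSeries_apply (hH.isPointwiseNilpotent (h1 z)) f (hn C (F z) (h1 z)),
      Finset.sum_apply]
    refine Finset.sum_congr rfl fun k _ => ?_
    rw [Algebra.smul_def]
    rfl
  rw [this]
  exact sum_mem fun k _ => mul_mem (hS _) (h.pow hS k x)

theorem EvalMem.convExp (h : EvalMem S F) (h1 : ∀ z, F z 1 = 0) :
    EvalMem S fun z => convExp (F z) := h.convSeries hS hH h1 _

theorem EvalMem.convLog (h : EvalMem S F) (h1 : ∀ z, F z 1 = 1) :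
    EvalMem S fun z => convLog (F z) :=
  (h.sub (evalMem_const hS 1)).convSeries hS hH (fun z => by
    simp [h1 z]) _

theorem EvalMem.convBCH (h : EvalMem S F) (h' : EvalMem S F') (h1 : ∀ z, F z 1 = 0)
    (h1' : ∀ z, F' z 1 = 0) : EvalMem S fun z => convBCH (F z) (F' z) :=
  ((h.convExp hS hH h1).mul (h'.convExp hS hH h1')).convLog hS hH fun z => by
    rw [ConvHom.mul_apply_one, convExp_apply_one (hH.isPointwiseNilpotent (h1 z)) (h1 z),
      convExp_apply_one (hH.isPointwiseNilpotent (h1' z)) (h1' z), mul_one]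

end FunctionRings

/-! ### Rules for directional derivatives -/

section DirectionalDerivatives

variable {𝕂 : Type*} [RCLike 𝕂] {E : Type*} [AddCommGroup E] [Module 𝕂 E]
variable {F : Type*} [AddCommGroup F] [Module 𝕂 F] [TopologicalSpace F]

theorem HasDirDeriv.unique [T2Space F] {f : E → F} {x h : E} {v w : F}
    (hv : HasDirDeriv 𝕂 f x h v) (hw : HasDirDeriv 𝕂 f x h w) : v = w :=
  tendsto_nhds_unique hv hw

theorem hasDirDeriv_const (c : F) (x h : E) : HasDirDeriv 𝕂 (fun _ : E => c) x h 0 := by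
  simp only [HasDirDeriv, sub_self, smul_zero]
  exact tendsto_const_nhds

theorem IsLinearMap.hasDirDeriv {f : E → F} (hf : IsLinearMap 𝕂 f) (x h : E) :
    HasDirDeriv 𝕂 f x h (f h) := by
  refine tendsto_const_nhds.congr' ?_
  filter_upwards [self_mem_nhdsWithin] with t ht
  rw [hf.map_add, hf.map_smul, add_sub_cancel_left, inv_smul_smul₀ ht]

theorem LinearMap.hasDirDeriv (f : E →ₗ[𝕂] F) (x h : E) : HasDirDeriv 𝕂 f x h (f h) :=
  f.isLinear.hasDirDeriv x h

theorem HasDirDeriv.add [ContinuousAdd F] {f g : E → F} {x h : E} {v w : F}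
    (hf : HasDirDeriv 𝕂 f x h v) (hg : HasDirDeriv 𝕂 g x h w) :
    HasDirDeriv 𝕂 (fun z => f z + g z) x h (v + w) := by
  refine (Tendsto.add hf hg).congr fun t => ?_
  rw [← smul_add, add_sub_add_comm]

theorem HasDirDeriv.sub [IsTopologicalAddGroup F] {f g : E → F} {x h : E} {v w : F}
    (hf : HasDirDeriv 𝕂 f x h v) (hg : HasDirDeriv 𝕂 g x h w) :
    HasDirDeriv 𝕂 (fun z => f z - g z) x h (v - w) := by
  refine (Tendsto.sub hf hg).congr fun t => ?_
  rw [← smul_sub, sub_sub_sub_comm]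

theorem HasDirDeriv.neg [IsTopologicalAddGroup F] {f : E → F} {x h : E} {v : F}
    (hf : HasDirDeriv 𝕂 f x h v) : HasDirDeriv 𝕂 (fun z => -f z) x h (-v) := by
  refine (Tendsto.neg hf).congr fun t => ?_
  rw [← smul_neg, neg_sub_neg, neg_sub]

theorem HasDirDeriv.const_smul [ContinuousConstSMul 𝕂 F] {f : E → F} {x h : E} {v : F}
    (hf : HasDirDeriv 𝕂 f x h v) (c : 𝕂) : HasDirDeriv 𝕂 (fun z => c • f z) x h (c • v) := by
  refine (Tendsto.const_smul hf c).congr fun t => ?_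
  rw [← smul_sub, smul_comm]

theorem HasDirDeriv.sum [ContinuousAdd F] {ι : Type*} (s : Finset ι) {f : ι → E → F} {x h : E}
    {v : ι → F} (hf : ∀ i ∈ s, HasDirDeriv 𝕂 (f i) x h (v i)) :
    HasDirDeriv 𝕂 (fun z => ∑ i ∈ s, f i z) x h (∑ i ∈ s, v i) := by
  refine (tendsto_finsetSum s hf).congr fun t => ?_
  rw [← Finset.smul_sum, Finset.sum_sub_distrib]

/-- Continuity along the line in the direction `h`, which is all that the product rule needs. -/
theorem HasDirDeriv.tendsto [IsTopologicalAddGroup F] [ContinuousSMul 𝕂 F] {f : E → F} {x h : E}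
    {v : F} (hf : HasDirDeriv 𝕂 f x h v) :
    Tendsto (fun t : 𝕂 => f (x + t • h)) (𝓝[≠] 0) (𝓝 (f x)) := by
  have h1 : Tendsto (fun t : 𝕂 => t) (𝓝[≠] 0) (𝓝 0) := tendsto_nhdsWithin_of_tendsto_nhds tendsto_id
  have h2 := (h1.smul hf).add (tendsto_const_nhds (x := f x))
  rw [zero_smul, zero_add] at h2
  refine h2.congr' ?_
  filter_upwards [self_mem_nhdsWithin] with t ht
  rw [smul_inv_smul₀ ht, sub_add_cancel]

theorem HasDirDeriv.mul {A : Type*} [Ring A] [Algebra 𝕂 A] [TopologicalSpace A]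
    [IsTopologicalRing A] [ContinuousSMul 𝕂 A] {f g : E → A} {x h : E} {v w : A}
    (hf : HasDirDeriv 𝕂 f x h v) (hg : HasDirDeriv 𝕂 g x h w) :
    HasDirDeriv 𝕂 (fun z => f z * g z) x h (v * g x + f x * w) := by
  refine ((Tendsto.mul hf hg.tendsto).add (Tendsto.mul (tendsto_const_nhds (x := f x)) hg)).congr
    fun t => ?_
  rw [smul_mul_assoc, mul_smul_comm, ← smul_add, sub_mul, mul_sub, sub_add_sub_cancel]

theorem hasDirDeriv_iff_of_isInducing {F' : Type*} [AddCommGroup F'] [Module 𝕂 F']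
    [TopologicalSpace F'] (e : F →ₗ[𝕂] F') (he : IsInducing e) {f : E → F} {x h : E} {v : F} :
    HasDirDeriv 𝕂 f x h v ↔ HasDirDeriv 𝕂 (fun z => e (f z)) x h (e v) := by
  rw [HasDirDeriv, HasDirDeriv, he.tendsto_nhds_iff]
  refine tendsto_congr fun t => ?_
  simp

/-- The difference quotients lie in the range of `e`, so their limit does too because the range is
closed. No completeness is needed. -/
theorem exists_hasDirDeriv_of_isClosedEmbedding {F' : Type*} [AddCommGroup F'] [Module 𝕂 F']
    [TopologicalSpace F'] (e : F →ₗ[𝕂] F') (he : IsClosedEmbedding e) {f : E → F} {x h : E}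
    {v : F'} (hf : HasDirDeriv 𝕂 (fun z => e (f z)) x h v) :
    ∃ u, e u = v ∧ HasDirDeriv 𝕂 f x h u := by
  obtain ⟨u, hu⟩ : v ∈ range e := by
    refine he.isClosed_range.mem_of_tendsto hf (Eventually.of_forall fun t => ?_)
    exact ⟨t⁻¹ • (f (x + t • h) - f x), by simp⟩
  refine ⟨u, hu, (hasDirDeriv_iff_of_isInducing e he.isInducing).2 ?_⟩
  rwa [hu]

theorem hasDirDeriv_pi {I : Type*} {f : E → I → F} {x h : E} {v : I → F} :
    HasDirDeriv 𝕂 f x h v ↔ ∀ i, HasDirDeriv 𝕂 (fun z => f z i) x h (v i) := tendsto_pi_nhds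

end DirectionalDerivatives

/-! ### Smoothness of continuous polynomial maps -/

section PolynomialMaps

variable {𝕂 : Type*} [RCLike 𝕂] {E : Type*} [AddCommGroup E] [Module 𝕂 E] [TopologicalSpace E]
variable {C : Type*} [CommRing C] [Algebra 𝕂 C] [TopologicalSpace C]

variable (𝕂 E C) in
/-- The ring of functions generated by the constants and the continuous linear maps. -/
def polyMaps : Subring (E → C) :=
  Subring.closure (range (fun c => fun _ => c) ∪ range fun L : E →L[𝕂] C => ⇑L)

theorem const_mem_polyMaps (c : C) : (fun _ => c) ∈ polyMaps 𝕂 E C :=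
  Subring.subset_closure (Or.inl ⟨c, rfl⟩)

theorem clm_mem_polyMaps (L : E →L[𝕂] C) : ⇑L ∈ polyMaps 𝕂 E C :=
  Subring.subset_closure (Or.inr ⟨L, rfl⟩)

theorem comp_mem_polyMaps {E' : Type*} [AddCommGroup E'] [Module 𝕂 E'] [TopologicalSpace E']
    {f : E → C} (hf : f ∈ polyMaps 𝕂 E C) (L : E' →L[𝕂] E) :
    (fun z => f (L z)) ∈ polyMaps 𝕂 E' C := by
  induction hf using Subring.closure_induction with
  | mem f hf =>
    obtain ⟨c, rfl⟩ | ⟨M, rfl⟩ := hf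
    · exact const_mem_polyMaps c
    · exact clm_mem_polyMaps (M.comp L)
  | zero => exact zero_mem _
  | one => exact one_mem _
  | add f g _ _ hf hg => exact add_mem hf hg
  | neg f _ hf => exact neg_mem hf
  | mul f g _ _ hf hg => exact mul_mem hf hg

variable [IsTopologicalRing C]

theorem continuous_of_mem_polyMaps {f : E → C} (hf : f ∈ polyMaps 𝕂 E C) : Continuous f := by
  induction hf using Subring.closure_induction with
  | mem f hf =>
    obtain ⟨c, rfl⟩ | ⟨M, rfl⟩ := hf
    · exact continuous_const
    · exact M.continuous
  | zero => exact continuous_const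
  | one => exact continuous_const
  | add f g _ _ hf hg => exact hf.add hg
  | neg f _ hf => exact hf.neg
  | mul f g _ _ hf hg => exact hf.mul hg

variable [ContinuousSMul 𝕂 C]

/-- An infinite sequence `Y` of directions is carried as a parameter. The derivative in the
direction `Y j` is then a polynomial map on the same space, and the construction can be iterated. -/
theorem exists_hasDirDeriv_of_mem_polyMaps {f : E × (ℕ → E) → C}
    (hf : f ∈ polyMaps 𝕂 (E × (ℕ → E)) C) (j : ℕ) :
    ∃ f' ∈ polyMaps 𝕂 (E × (ℕ → E)) C, ∀ x Y,
      HasDirDeriv 𝕂 (fun z => f (z, Y)) x (Y j) (f' (x, Y)) := by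
  induction hf using Subring.closure_induction with
  | mem f hf =>
    obtain ⟨c, rfl⟩ | ⟨M, rfl⟩ := hf
    · exact ⟨0, zero_mem _, fun x Y => hasDirDeriv_const c x _⟩
    · refine ⟨_, clm_mem_polyMaps ((M.comp (ContinuousLinearMap.inl 𝕂 E (ℕ → E))).comp
        ((ContinuousLinearMap.proj j).comp (ContinuousLinearMap.snd 𝕂 E (ℕ → E)))),
        fun x Y => ?_⟩
      refine tendsto_const_nhds.congr' ?_
      filter_upwards [self_mem_nhdsWithin] with t ht
      have h1 : M (x + t • Y j, Y) = M (x, Y) + t • M (Y j, 0) := by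
        rw [← map_smul, ← map_add]
        simp
      rw [h1, add_sub_cancel_left, inv_smul_smul₀ ht]
      rfl
  | zero => exact ⟨0, zero_mem _, fun x Y => hasDirDeriv_const 0 x _⟩
  | one => exact ⟨0, zero_mem _, fun x Y => hasDirDeriv_const 1 x _⟩
  | add f g _ _ hf hg =>
    obtain ⟨f', hf', h1⟩ := hf
    obtain ⟨g', hg', h2⟩ := hg
    exact ⟨f' + g', add_mem hf' hg', fun x Y => (h1 x Y).add (h2 x Y)⟩
  | neg f _ hf =>
    obtain ⟨f', hf', h1⟩ := hf
    exact ⟨-f', neg_mem hf', fun x Y => (h1 x Y).neg⟩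
  | mul f g hfm hgm hf hg =>
    obtain ⟨f', hf', h1⟩ := hf
    obtain ⟨g', hg', h2⟩ := hg
    exact ⟨f' * g + f * g', add_mem (mul_mem hf' hgm) (mul_mem hfm hg'),
      fun x Y => (h1 x Y).mul (h2 x Y)⟩

variable {F : Type*} [AddCommGroup F] [Module 𝕂 F] [TopologicalSpace F]

/-- A map into a closed subspace of a power of `C` with components in `polyMaps` is smooth. -/
theorem isBastiani_of_mem_polyMaps [T2Space F] {I : Type*} (e : F →ₗ[𝕂] I → C)
    (he : IsClosedEmbedding e) {f : E → F} (hf : ∀ i, (fun x => e (f x) i) ∈ polyMaps 𝕂 E C)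
    (U : Set E) : IsBastiani 𝕂 ⊤ f U := by
  let T : Type _ := {Φ : E × (ℕ → E) → F // ∀ i, (fun p => e (Φ p) i) ∈
    polyMaps 𝕂 (E × (ℕ → E)) C}
  have step : ∀ (k : ℕ) (Φ : T), ∃ Φ' : T, ∀ x Y,
      HasDirDeriv 𝕂 (fun z => Φ.1 (z, Y)) x (Y k) (Φ'.1 (x, Y)) := by
    intro k Φ
    choose f' hf' hd using fun i => exists_hasDirDeriv_of_mem_polyMaps (Φ.2 i) k
    have h1 : ∀ p : E × (ℕ → E), ∃ u, e u = (fun i => f' i p) ∧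
        HasDirDeriv 𝕂 (fun z => Φ.1 (z, p.2)) p.1 (p.2 k) u := fun p =>
      exists_hasDirDeriv_of_isClosedEmbedding e he (hasDirDeriv_pi.2 fun i => hd i p.1 p.2)
    choose Φ' hΦ' hΦ'd using h1
    refine ⟨⟨Φ', fun i => ?_⟩, fun x Y => hΦ'd (x, Y)⟩
    simp only [hΦ']
    exact hf' i
  choose next hnext using step
  let Φ : ℕ → T := fun k => Nat.rec
    ⟨fun p => f p.1, fun i => comp_mem_polyMaps (hf i) (ContinuousLinearMap.fst 𝕂 E (ℕ → E))⟩
    (fun k Φ => next k Φ) k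
  have hΦ : ∀ k x Y, HasDirDeriv 𝕂 (fun z => (Φ k).1 (z, Y)) x (Y k) ((Φ (k + 1)).1 (x, Y)) :=
    fun k => hnext k (Φ k)
  -- The `k`-th derivative sees only the first `k` directions, by uniqueness of limits. This makes
  -- the padding by `0` in `ext` below harmless.
  have hdep : ∀ k x (Y Y' : ℕ → E), (∀ n < k, Y n = Y' n) → (Φ k).1 (x, Y) = (Φ k).1 (x, Y') := by
    intro k
    induction k with
    | zero => intro x Y Y' _; rfl
    | succ k ih =>
      intro x Y Y' h
      have h1 := hΦ k x Y
      have h2 := hΦ k x Y'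
      rw [← h k k.lt_succ_self] at h2
      simp only [fun z => ih z Y Y' fun n hn => h n (hn.trans k.lt_succ_self)] at h1
      exact h1.unique h2
  let ext : (k : ℕ) → (Fin k → E) → ℕ → E := fun k y n => if h : n < k then y ⟨n, h⟩ else 0
  refine ⟨fun k x y => (Φ k).1 (x, ext k y), fun x _ y => rfl, fun k _ x _ y h => ?_,
    fun k _ => Continuous.continuousOn ?_⟩
  · have h1 := hΦ k x (ext (k + 1) (Fin.snoc y h : Fin (k + 1) → E))
    have h2 : ext (k + 1) (Fin.snoc y h : Fin (k + 1) → E) k = h := by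
      simp [ext, Fin.snoc]
    rw [h2] at h1
    refine Eq.mp ?_ h1
    congr 1
    funext z
    refine hdep k z _ _ fun n hn => ?_
    simp [ext, Fin.snoc, hn, hn.trans k.lt_succ_self]
  · have h1 : Continuous (Φ k).1 := by
      rw [he.isInducing.continuous_iff]
      exact continuous_pi fun i => continuous_of_mem_polyMaps ((Φ k).2 i)
    refine h1.comp (continuous_fst.prodMk (continuous_pi fun n => ?_))
    by_cases hn : n < k
    · simp only [ext, hn, dif_pos]
      exact (continuous_apply _).comp continuous_snd
    · simp only [ext, hn, dif_neg, not_false_eq_true]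
      exact continuous_const

end PolynomialMaps

/-! ### Complexification of spaces -/

section ComplexificationBasics

namespace Complexification

variable {𝕂 E : Type*}

variable (𝕂) in
/-- The element `u + i v` of the complexification. -/
def mk (u v : E) : Complexification 𝕂 E := ((u, v) : E × E)

/-- The real part. -/
def re (p : Complexification 𝕂 E) : E := p.1

/-- The imaginary part. -/
def im (p : Complexification 𝕂 E) : E := p.2

theorem ext {p q : Complexification 𝕂 E} (h1 : p.re = q.re) (h2 : p.im = q.im) : p = q :=
  Prod.ext h1 h2

@[simp] theorem re_mk (u v : E) : (mk 𝕂 u v).re = u := rfl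

@[simp] theorem im_mk (u v : E) : (mk 𝕂 u v).im = v := rfl

section Topology

variable [TopologicalSpace E]

theorem continuous_re : Continuous (re : Complexification 𝕂 E → E) :=
  continuous_fst (X := E) (Y := E)

theorem continuous_im : Continuous (im : Complexification 𝕂 E → E) :=
  continuous_snd (X := E) (Y := E)

theorem continuous_mk {X : Type*} [TopologicalSpace X] {f g : X → E}
    (hf : Continuous f) (hg : Continuous g) : Continuous fun x => mk 𝕂 (f x) (g x) :=
  Continuous.prodMk hf hg

instance [T2Space E] : T2Space (Complexification 𝕂 E) := inferInstanceAs (T2Space (E × E))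

end Topology

variable [AddCommGroup E]

@[simp] theorem re_add (p q : Complexification 𝕂 E) : (p + q).re = p.re + q.re := rfl

@[simp] theorem im_add (p q : Complexification 𝕂 E) : (p + q).im = p.im + q.im := rfl

@[simp] theorem re_zero : (0 : Complexification 𝕂 E).re = 0 := rfl

@[simp] theorem im_zero : (0 : Complexification 𝕂 E).im = 0 := rfl

variable [RCLike 𝕂] [Module 𝕂 E]

@[simp] theorem re_smul (z : ℂ) (p : Complexification 𝕂 E) :
    (z • p).re = (z.re : 𝕂) • p.re - (z.im : 𝕂) • p.im := rfl

@[simp] theorem im_smul (z : ℂ) (p : Complexification 𝕂 E) :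
    (z • p).im = (z.re : 𝕂) • p.im + (z.im : 𝕂) • p.re := rfl

end Complexification

end ComplexificationBasics

/-! ### Continuous linear maps are smooth and analytic -/

section LinearMaps

variable {𝕂 : Type*} [RCLike 𝕂] {E : Type*} [AddCommGroup E] [Module 𝕂 E] [TopologicalSpace E]
variable {F : Type*} [AddCommGroup F] [Module 𝕂 F] [TopologicalSpace F]

theorem IsLinearMap.isBastiani {f : E → F} (hf : IsLinearMap 𝕂 f) (hc : Continuous f) (r : ℕ∞)
    (U : Set E) : IsBastiani 𝕂 r f U := by
  refine ⟨fun k => match k with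
    | 0 => fun x _ => f x
    | 1 => fun _ y => f (y 0)
    | _ + 2 => fun _ _ => 0, fun x _ y => rfl, fun k _ x _ y h => ?_, fun k _ => ?_⟩
  · match k with
    | 0 => exact hf.hasDirDeriv x h
    | 1 => exact hasDirDeriv_const _ x h
    | k + 2 => exact hasDirDeriv_const _ x h
  · match k with
    | 0 => exact (hc.comp continuous_fst).continuousOn
    | 1 => exact (hc.comp ((continuous_apply 0).comp continuous_snd)).continuousOn
    | k + 2 => exact continuousOn_const

/-- The complexification of a linear map. -/
def Complexification.map (f : E →ₗ[𝕂] F) : Complexification 𝕂 E →ₗ[ℂ] Complexification 𝕂 F where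
  toFun p := mk 𝕂 (f p.re) (f p.im)
  map_add' p q := by apply Complexification.ext <;> simp
  map_smul' c p := by apply Complexification.ext <;> simp

theorem Complexification.continuous_map (f : E →ₗ[𝕂] F) (hf : Continuous f) :
    Continuous (Complexification.map f) :=
  continuous_mk (hf.comp continuous_re) (hf.comp continuous_im)

theorem LinearMap.isRealAnalytic (f : E →ₗ[𝕂] F) (hc : Continuous f) (U : Set E) :
    IsRealAnalytic 𝕂 f U :=
  ⟨univ, Complexification.map f, isOpen_univ, fun _ _ => mem_univ _,
    (Complexification.map f).isLinear.isBastiani (Complexification.continuous_map f hc) _ _,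
    fun _ _ => Complexification.ext rfl f.map_zero⟩

/-- Continuous linear maps are smooth and analytic. -/
theorem IsLinearMap.isCk {f : E → F} (hf : IsLinearMap 𝕂 f) (hc : Continuous f)
    (r : WithTop ℕ∞) (U : Set E) : IsCk 𝕂 r f U := by
  induction r using WithTop.recTopCoe with
  | top => exact ⟨fun _ => (hf.mk' f).isRealAnalytic hc U, fun _ => hf.isBastiani hc ⊤ U⟩
  | coe r => exact hf.isBastiani hc r U

end LinearMaps

/-! ### Complexification of the target algebra -/

section ComplexifiedAlgebra

namespace Complexification

variable {𝕜 : Type*} {B : Type*} [CommRing B]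

instance : Mul (Complexification 𝕜 B) where
  mul p q := mk 𝕜 (p.re * q.re - p.im * q.im) (p.re * q.im + p.im * q.re)

instance : One (Complexification 𝕜 B) where
  one := mk 𝕜 1 0

@[simp] theorem re_mul (p q : Complexification 𝕜 B) :
    (p * q).re = p.re * q.re - p.im * q.im := rfl

@[simp] theorem im_mul (p q : Complexification 𝕜 B) :
    (p * q).im = p.re * q.im + p.im * q.re := rfl

@[simp] theorem re_one : (1 : Complexification 𝕜 B).re = 1 := rfl

@[simp] theorem im_one : (1 : Complexification 𝕜 B).im = 0 := rfl

instance : CommRing (Complexification 𝕜 B) where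
  __ := (inferInstance : AddCommGroup (Complexification 𝕜 B))
  left_distrib p q r := by
    apply Complexification.ext <;> simp <;> ring
  right_distrib p q r := by apply Complexification.ext <;> simp <;> ring
  zero_mul p := by apply Complexification.ext <;> simp
  mul_zero p := by apply Complexification.ext <;> simp
  mul_assoc p q r := by apply Complexification.ext <;> simp <;> ring
  one_mul p := by apply Complexification.ext <;> simp
  mul_one p := by apply Complexification.ext <;> simp
  mul_comm p q := by apply Complexification.ext <;> simp <;> ring

variable [RCLike 𝕜] [Algebra 𝕜 B]

instance : Algebra ℂ (Complexification 𝕜 B) := Algebra.ofModule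
  (fun z p q => by
    apply Complexification.ext <;> simp [Algebra.smul_def] <;> ring)
  (fun z p q => by
    apply Complexification.ext <;> simp [Algebra.smul_def] <;> ring)

/-- The `ℂ`-structure serves the calculus, while this componentwise `𝕜`-structure makes convolution
of `𝕜`-linear maps `H → B_ℂ` available. For `𝕜 = ℂ` the two actions differ. -/
instance : Algebra 𝕜 (Complexification 𝕜 B) where
  smul c p := mk 𝕜 (c • p.re) (c • p.im)
  algebraMap :=
    { toFun := fun c => mk 𝕜 (algebraMap 𝕜 B c) 0
      map_one' := by apply Complexification.ext <;> simp
      map_mul' := fun c d => by apply Complexification.ext <;> simp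
      map_zero' := by apply Complexification.ext <;> simp
      map_add' := fun c d => by apply Complexification.ext <;> simp }
  commutes' c p := mul_comm _ _
  smul_def' c p := by
    apply Complexification.ext
    · change c • p.re = algebraMap 𝕜 B c * p.re - 0 * p.im
      rw [Algebra.smul_def, zero_mul, sub_zero]
    · change c • p.im = algebraMap 𝕜 B c * p.im + 0 * p.re
      rw [Algebra.smul_def, zero_mul, add_zero]

@[simp] theorem re_smul_base (c : 𝕜) (p : Complexification 𝕜 B) : (c • p).re = c • p.re := rfl

@[simp] theorem im_smul_base (c : 𝕜) (p : Complexification 𝕜 B) : (c • p).im = c • p.im := rfl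

/-- The inclusion of `B` into its complexification. -/
def ofBaseAlgHom : B →ₐ[𝕜] Complexification 𝕜 B where
  toFun := ofBase 𝕜
  map_one' := rfl
  map_mul' a b := by
    apply Complexification.ext
    · change a * b = a * b - 0 * 0
      simp
    · change 0 = a * 0 + 0 * b
      simp
  map_zero' := rfl
  map_add' a b := by
    apply Complexification.ext
    · rfl
    · exact (add_zero (0 : B)).symm
  commutes' c := rfl

variable [TopologicalSpace B] [IsTopologicalRing B] [ContinuousSMul 𝕜 B]

instance : IsTopologicalRing (Complexification 𝕜 B) where
  continuous_add := continuous_mk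
    ((continuous_re.comp continuous_fst).add (continuous_re.comp continuous_snd))
    ((continuous_im.comp continuous_fst).add (continuous_im.comp continuous_snd))
  continuous_mul := continuous_mk
    (((continuous_re.comp continuous_fst).mul (continuous_re.comp continuous_snd)).sub
      ((continuous_im.comp continuous_fst).mul (continuous_im.comp continuous_snd)))
    (((continuous_re.comp continuous_fst).mul (continuous_im.comp continuous_snd)).add
      ((continuous_im.comp continuous_fst).mul (continuous_re.comp continuous_snd)))
  continuous_neg := continuous_mk continuous_re.neg continuous_im.neg

instance : ContinuousSMul ℂ (Complexification 𝕜 B) where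
  continuous_smul := by
    have h1 : Continuous fun p : ℂ × Complexification 𝕜 B => ((p.1.re : ℝ) : 𝕜) :=
      RCLike.continuous_ofReal.comp (Complex.continuous_re.comp continuous_fst)
    have h2 : Continuous fun p : ℂ × Complexification 𝕜 B => ((p.1.im : ℝ) : 𝕜) :=
      RCLike.continuous_ofReal.comp (Complex.continuous_im.comp continuous_fst)
    have h3 := continuous_re.comp (continuous_snd (X := ℂ) (Y := Complexification 𝕜 B))
    have h4 := continuous_im.comp (continuous_snd (X := ℂ) (Y := Complexification 𝕜 B))
    exact continuous_mk ((h1.smul h3).sub (h2.smul h4)) ((h1.smul h4).add (h2.smul h3))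

end Complexification

variable {𝕜 : Type*} [RCLike 𝕜] {H : Type*} [Ring H] [HopfAlgebra 𝕜 H]
variable {B : Type*} [CommRing B] [Algebra 𝕜 B]

/-- The map `φ + i χ` with values in the complexification. -/
def ConvHom.complexify (φ χ : ConvHom 𝕜 H B) : ConvHom 𝕜 H (Complexification 𝕜 B) :=
  WithConv.toConv
    { toFun := fun x => Complexification.mk 𝕜 (φ x) (χ x)
      map_add' := fun x y => by apply Complexification.ext <;> simp
      map_smul' := fun c x => by apply Complexification.ext <;> simp }

theorem ConvHom.complexify_apply (φ χ : ConvHom 𝕜 H B) (x : H) :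
    ConvHom.complexify φ χ x = Complexification.mk 𝕜 (φ x) (χ x) := rfl

/-- The real part of a map with values in the complexification. -/
def ConvHom.re (φ : ConvHom 𝕜 H (Complexification 𝕜 B)) : ConvHom 𝕜 H B :=
  WithConv.toConv
    { toFun := fun x => (φ x).re
      map_add' := fun x y => by simp
      map_smul' := fun c x => by simp }

/-- The imaginary part of a map with values in the complexification. -/
def ConvHom.im (φ : ConvHom 𝕜 H (Complexification 𝕜 B)) : ConvHom 𝕜 H B :=
  WithConv.toConv
    { toFun := fun x => (φ x).im
      map_add' := fun x y => by simp
      map_smul' := fun c x => by simp }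

theorem ConvHom.complexify_re_im (φ : ConvHom 𝕜 H (Complexification 𝕜 B)) :
    ConvHom.complexify (ConvHom.re φ) (ConvHom.im φ) = φ := rfl

variable {J : Set H}

theorem IsAnnInfChar.complexify {φ χ : ConvHom 𝕜 H B} (hφ : IsAnnInfChar J φ)
    (hχ : IsAnnInfChar J χ) : IsAnnInfChar J (ConvHom.complexify φ χ) := by
  refine ⟨fun a b => ?_, fun x hx => ?_⟩
  · have h1 := hφ.isInfinitesimalChar a b
    have h2 := hχ.isInfinitesimalChar a b
    apply Complexification.ext <;> simp [ConvHom.complexify_apply, h1, h2]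
  · have h1 := hφ.ann x hx
    have h2 := hχ.ann x hx
    apply Complexification.ext <;> simp [ConvHom.complexify_apply, h1, h2]

theorem IsAnnInfChar.re {φ : ConvHom 𝕜 H (Complexification 𝕜 B)} (h : IsAnnInfChar J φ) :
    IsAnnInfChar J (ConvHom.re φ) := by
  refine ⟨fun a b => ?_, fun x hx => ?_⟩
  · exact congrArg Complexification.re (h.isInfinitesimalChar a b)
  · exact congrArg Complexification.re (h.ann x hx)

theorem IsAnnInfChar.im {φ : ConvHom 𝕜 H (Complexification 𝕜 B)} (h : IsAnnInfChar J φ) :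
    IsAnnInfChar J (ConvHom.im φ) := by
  refine ⟨fun a b => ?_, fun x hx => ?_⟩
  · exact congrArg Complexification.im (h.isInfinitesimalChar a b)
  · exact congrArg Complexification.im (h.ann x hx)

end ComplexifiedAlgebra

/-! ### Topology of pointwise convergence -/

section TopologicalConvolutionAlgebra

variable {𝕜 : Type*} [RCLike 𝕜] {H : Type*} [Ring H] [HopfAlgebra 𝕜 H]
variable {B : Type*} [CommRing B] [Algebra 𝕜 B] [TopologicalSpace B]

/-- The inclusion of `Hom (H, B)` into the space of all maps. -/
def ConvHom.evalMap : ConvHom 𝕜 H B →ₗ[𝕜] H → B where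
  toFun φ x := φ x
  map_add' _ _ := rfl
  map_smul' _ _ := rfl

theorem ConvHom.isInducing_evalMap :
    IsInducing (ConvHom.evalMap : ConvHom 𝕜 H B →ₗ[𝕜] H → B) := ⟨rfl⟩

theorem ConvHom.continuous_iff {X : Type*} [TopologicalSpace X] {F : X → ConvHom 𝕜 H B} :
    Continuous F ↔ ∀ x, Continuous fun z => F z x := by
  rw [ConvHom.isInducing_evalMap.continuous_iff, continuous_pi_iff]
  rfl

theorem ConvHom.continuous_eval (x : H) : Continuous fun φ : ConvHom 𝕜 H B => φ x :=
  ConvHom.continuous_iff.1 continuous_id x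

instance [IsTopologicalRing B] : IsTopologicalRing (ConvHom 𝕜 H B) where
  continuous_add := ConvHom.continuous_iff.2 fun x =>
    ((ConvHom.continuous_eval x).comp continuous_fst).add
      ((ConvHom.continuous_eval x).comp continuous_snd)
  continuous_mul := ConvHom.continuous_iff.2 fun x => by
    simp only [ConvHom.mul_apply_repr]
    exact continuous_finsetSum _ fun i _ => ((ConvHom.continuous_eval _).comp continuous_fst).mul
      ((ConvHom.continuous_eval _).comp continuous_snd)
  continuous_neg := ConvHom.continuous_iff.2 fun x => (ConvHom.continuous_eval x).neg

instance [ContinuousSMul 𝕜 B] : ContinuousSMul 𝕜 (ConvHom 𝕜 H B) where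
  continuous_smul := ConvHom.continuous_iff.2 fun x =>
    continuous_fst.smul ((ConvHom.continuous_eval x).comp continuous_snd)

/-- Linearity is a family of equations between continuous functions on `H → B`, hence a closed
condition as `B` is Hausdorff. -/
theorem ConvHom.isClosedEmbedding_evalMap [T2Space B] [IsTopologicalRing B] [ContinuousSMul 𝕜 B] :
    IsClosedEmbedding (ConvHom.evalMap : ConvHom 𝕜 H B →ₗ[𝕜] H → B) := by
  refine ⟨⟨ConvHom.isInducing_evalMap, fun φ χ h => ConvHom.ext_apply (congrFun h)⟩, ?_⟩
  have : range (ConvHom.evalMap : ConvHom 𝕜 H B →ₗ[𝕜] H → B) =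
      {f | ∀ x y, f (x + y) = f x + f y} ∩ {f | ∀ (c : 𝕜) (x), f (c • x) = c • f x} := by
    ext f
    constructor
    · rintro ⟨φ, rfl⟩
      exact ⟨fun x y => map_add φ.ofConv x y, fun c x => map_smul φ.ofConv c x⟩
    · rintro ⟨h1, h2⟩
      exact ⟨WithConv.toConv { toFun := f, map_add' := h1, map_smul' := h2 }, rfl⟩
  rw [this]
  refine IsClosed.inter ?_ ?_
  · simp only [ofPred_forall]
    exact isClosed_iInter fun x => isClosed_iInter fun y => isClosed_eq (by fun_prop) (by fun_prop)
  · simp only [ofPred_forall]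
    exact isClosed_iInter fun c => isClosed_iInter fun x => isClosed_eq (by fun_prop) (by fun_prop)

theorem isClosed_setOf_isAnnInfChar [T2Space B] [IsTopologicalRing B] [ContinuousSMul 𝕜 B]
    (J : Set H) : IsClosed {ψ : ConvHom 𝕜 H B | IsAnnInfChar J ψ} := by
  have : {ψ : ConvHom 𝕜 H B | IsAnnInfChar J ψ} =
      {ψ | ∀ a b : H, ψ (a * b) =
        Coalgebra.counit (R := 𝕜) b • ψ a + Coalgebra.counit (R := 𝕜) a • ψ b} ∩
      {ψ | ∀ x ∈ J, ψ x = 0} := by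
    ext ψ
    exact ⟨fun h => ⟨h.1, h.2⟩, fun h => ⟨h.1, h.2⟩⟩
  rw [this]
  have hc : ∀ x : H, Continuous fun φ : ConvHom 𝕜 H B => φ x := ConvHom.continuous_eval
  refine IsClosed.inter ?_ ?_
  · simp only [ofPred_forall]
    exact isClosed_iInter fun a => isClosed_iInter fun b => isClosed_eq (hc _)
      (((hc a).const_smul _).add ((hc b).const_smul _))
  · simp only [ofPred_forall]
    exact isClosed_iInter fun x => isClosed_iInter fun _ => isClosed_eq (hc x) continuous_const

end TopologicalConvolutionAlgebra

/-! ### The exponential chart and the multiplication in it -/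

section ExponentialModels

universe w u v

variable {𝕜 : Type u} [RCLike 𝕜] {H : Type v} [Ring H] [HopfAlgebra 𝕜 H]
variable {B : Type w} [CommRing B] [Algebra 𝕜 B] [TopologicalSpace B]
variable {E : Type*} [AddCommGroup E] [Module 𝕜 E] [TopologicalSpace E]
variable {G : Type*} [Group G] [TopologicalSpace G]

/-- `E` and `G` are, via `ι` and `γ`, the space of infinitesimal characters vanishing on `J`, and
the group of characters which agree with the counit on `J`. -/
structure IsCharModel (J : Set H) (ι : E →ₗ[𝕜] ConvHom 𝕜 H B) (γ : G →* ConvHom 𝕜 H B) : Prop where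
  isEmbedding_lie : IsEmbedding ι
  range_lie : range ι = {ψ | IsAnnInfChar J ψ}
  isEmbedding_group : IsEmbedding γ
  range_group : range γ = {φ | IsAnnChar J φ}
  isConilpotent : IsConilpotent.{w} 𝕜 H
  annIsConvClosed : AnnIsConvClosed.{w} 𝕜 J

namespace IsCharModel

variable {J : Set H} {ι : E →ₗ[𝕜] ConvHom 𝕜 H B} {γ : G →* ConvHom 𝕜 H B}
variable (M : IsCharModel J ι γ)
include M

theorem isAnnInfChar (v : E) : IsAnnInfChar J (ι v) := M.range_lie.le (mem_range_self v)

theorem exists_lie_eq {ψ : ConvHom 𝕜 H B} (h : IsAnnInfChar J ψ) : ∃ v, ι v = ψ :=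
  M.range_lie.ge h

theorem isAnnChar (g : G) : IsAnnChar J (γ g) := M.range_group.le (mem_range_self g)

theorem exists_group_eq {φ : ConvHom 𝕜 H B} (h : IsAnnChar J φ) : ∃ g, γ g = φ :=
  M.range_group.ge h

theorem apply_one (v : E) : ι v 1 = 0 := (M.isAnnInfChar v).isInfinitesimalChar.map_one

theorem isPointwiseNilpotent (v : E) : IsPointwiseNilpotent (ι v) :=
  M.isConilpotent.isPointwiseNilpotent (M.apply_one v)

theorem exists_exp (v : E) : ∃ g : G, γ g = convExp (ι v) :=
  M.exists_group_eq ((M.isAnnInfChar v).isAnnChar_convExp M.isConilpotent M.annIsConvClosed)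

theorem exists_log (g : G) : ∃ v : E, ι v = convLog (γ g) :=
  M.exists_lie_eq ((M.isAnnChar g).isAnnInfChar_convLog M.isConilpotent M.annIsConvClosed)

variable [IsTopologicalRing B]

/-- The exponential map as a homeomorphism. -/
noncomputable def expHomeo : E ≃ₜ G where
  toFun v := (M.exists_exp v).choose
  invFun g := (M.exists_log g).choose
  left_inv v := by
    apply M.isEmbedding_lie.injective
    rw [(M.exists_log _).choose_spec, (M.exists_exp v).choose_spec,
      (M.isAnnInfChar v).convLog_convExp M.isConilpotent]
  right_inv g := by
    apply M.isEmbedding_group.injective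
    rw [(M.exists_exp _).choose_spec, (M.exists_log g).choose_spec,
      (M.isAnnChar g).isConvChar.convExp_convLog M.isConilpotent]
  continuous_toFun := by
    -- With the ring of continuous functions, `EvalMem` is pointwise continuity, so
    -- `EvalMem.convExp` is the continuity of `exp`.
    let S : Subring (E → B) :=
      { carrier := {f | Continuous f}
        mul_mem' := fun hf hg => Continuous.mul hf hg
        one_mem' := continuous_const
        add_mem' := fun hf hg => Continuous.add hf hg
        zero_mem' := continuous_const
        neg_mem' := fun hf => Continuous.neg hf }
    rw [M.isEmbedding_group.continuous_iff, ConvHom.continuous_iff]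
    have h : EvalMem S fun v => ι v := fun x =>
      (ConvHom.continuous_eval x).comp M.isEmbedding_lie.continuous
    intro x
    refine (h.convExp (fun c => continuous_const) M.isConilpotent M.apply_one x).congr fun v => ?_
    rw [Function.comp_apply, (M.exists_exp v).choose_spec]
  continuous_invFun := by
    let S : Subring (G → B) :=
      { carrier := {f | Continuous f}
        mul_mem' := fun hf hg => Continuous.mul hf hg
        one_mem' := continuous_const
        add_mem' := fun hf hg => Continuous.add hf hg
        zero_mem' := continuous_const
        neg_mem' := fun hf => Continuous.neg hf }
    rw [M.isEmbedding_lie.continuous_iff, ConvHom.continuous_iff]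
    have h : EvalMem S fun g => γ g := fun x =>
      (ConvHom.continuous_eval x).comp M.isEmbedding_group.continuous
    intro x
    refine (h.convLog (fun c => continuous_const) M.isConilpotent
      (fun g => (M.isAnnChar g).isConvChar.map_one) x).congr fun g => ?_
    rw [Function.comp_apply, (M.exists_log g).choose_spec]

theorem coe_expHomeo (v : E) : γ (M.expHomeo v) = convExp (ι v) := (M.exists_exp v).choose_spec

theorem coe_expHomeo_symm (g : G) : ι (M.expHomeo.symm g) = convLog (γ g) :=
  (M.exists_log g).choose_spec

/-- The group multiplication in the exponential chart. -/
noncomputable def bchMap (p : E × E) : E := M.expHomeo.symm (M.expHomeo p.1 * M.expHomeo p.2)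

theorem coe_bchMap (p : E × E) : ι (M.bchMap p) = convBCH (ι p.1) (ι p.2) := by
  rw [bchMap, coe_expHomeo_symm, map_mul, coe_expHomeo, coe_expHomeo]
  rfl

theorem expHomeo_zero : M.expHomeo 0 = 1 := by
  apply M.isEmbedding_group.injective
  rw [coe_expHomeo, map_zero, convExp_zero, map_one]

theorem expHomeo_symm_one : M.expHomeo.symm 1 = 0 := by
  rw [Homeomorph.symm_apply_eq, expHomeo_zero]

theorem expHomeo_add_smul (s t : 𝕜) (v : E) :
    M.expHomeo ((s + t) • v) = M.expHomeo (s • v) * M.expHomeo (t • v) := by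
  apply M.isEmbedding_group.injective
  simp only [map_mul, coe_expHomeo, map_smul]
  exact convExp_add_smul (M.isPointwiseNilpotent v) s t

theorem expHomeo_neg (v : E) : M.expHomeo (-v) = (M.expHomeo v)⁻¹ := by
  have h := M.expHomeo_add_smul 1 (-1) v
  rw [add_neg_cancel, zero_smul, one_smul, neg_one_smul, expHomeo_zero] at h
  exact eq_inv_of_mul_eq_one_right h.symm

variable [T2Space B] [ContinuousSMul 𝕜 B]

theorem isClosedEmbedding_lie : IsClosedEmbedding ι :=
  ⟨M.isEmbedding_lie, by rw [M.range_lie]; exact isClosed_setOf_isAnnInfChar J⟩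

theorem isClosedEmbedding_evalMap : IsClosedEmbedding (ConvHom.evalMap ∘ₗ ι) :=
  ConvHom.isClosedEmbedding_evalMap.comp M.isClosedEmbedding_lie

theorem t2Space_lie : T2Space E := M.isClosedEmbedding_evalMap.isEmbedding.t2Space

/-- Evaluation at an element of `H`, as a continuous linear map. -/
def evalCLM (x : H) : E →L[𝕜] B where
  toFun v := ι v x
  map_add' v w := by simp
  map_smul' c v := by simp
  cont := (ConvHom.continuous_eval x).comp M.isEmbedding_lie.continuous

/-- Each evaluation of `log (exp ψ * exp χ)` is a polynomial in finitely many evaluations of `ψ` and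
`χ`, which are continuous linear functions of the point of `E × E`. -/
theorem isBastiani_bchMap (U : Set (E × E)) : IsBastiani 𝕜 ⊤ M.bchMap U := by
  have := M.t2Space_lie
  refine isBastiani_of_mem_polyMaps _ M.isClosedEmbedding_evalMap (fun x => ?_) U
  have h1 : EvalMem (polyMaps 𝕜 (E × E) B) fun p : E × E => ι p.1 := fun x =>
    clm_mem_polyMaps ((M.evalCLM x).comp (ContinuousLinearMap.fst 𝕜 E E))
  have h2 : EvalMem (polyMaps 𝕜 (E × E) B) fun p : E × E => ι p.2 := fun x =>
    clm_mem_polyMaps ((M.evalCLM x).comp (ContinuousLinearMap.snd 𝕜 E E))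
  have h3 := h1.convBCH const_mem_polyMaps M.isConilpotent h2 (fun p => M.apply_one p.1)
    (fun p => M.apply_one p.2)
  simp only [← M.coe_bchMap] at h3
  exact h3 x

/-- The evaluation map on the complexification. -/
def complexEvalMap : Complexification 𝕜 E →ₗ[ℂ] H → Complexification 𝕜 B :=
  LinearMap.pi fun x => Complexification.map (M.evalCLM x).toLinearMap

/-- Separating real and imaginary parts turns this map into two copies of the closed embedding of
`E`. -/
theorem isClosedEmbedding_complexEvalMap : IsClosedEmbedding M.complexEvalMap := by
  let unzip : (H → Complexification 𝕜 B) → (H → B) × (H → B) :=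
    fun f => (fun x => (f x).re, fun x => (f x).im)
  let zip : (H → B) × (H → B) → H → Complexification 𝕜 B :=
    fun p x => Complexification.mk 𝕜 (p.1 x) (p.2 x)
  have h1 : Continuous unzip :=
    (continuous_pi fun x => Complexification.continuous_re.comp (continuous_apply x)).prodMk
      (continuous_pi fun x => Complexification.continuous_im.comp (continuous_apply x))
  have h2 : Continuous zip := continuous_pi fun x => Complexification.continuous_mk
    ((continuous_apply x).comp continuous_fst) ((continuous_apply x).comp continuous_snd)
  have h3 : IsEmbedding unzip := .of_leftInverse (f := zip) (fun _ => rfl) h2 h1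
  exact IsClosedEmbedding.of_comp h3
    (M.isClosedEmbedding_evalMap.prodMap M.isClosedEmbedding_evalMap)

/-- The extension is the same formula `convBCH`, now for infinitesimal characters with values in the
complexification of `B`. -/
theorem isRealAnalytic_bchMap (U : Set (E × E)) : IsRealAnalytic 𝕜 M.bchMap U := by
  have := M.t2Space_lie
  let F₁ : Complexification 𝕜 (E × E) → ConvHom 𝕜 H (Complexification 𝕜 B) := fun z =>
    ConvHom.complexify (ι z.re.1) (ι z.im.1)
  let F₂ : Complexification 𝕜 (E × E) → ConvHom 𝕜 H (Complexification 𝕜 B) := fun z =>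
    ConvHom.complexify (ι z.re.2) (ι z.im.2)
  have hF₁ : ∀ z, IsAnnInfChar J (F₁ z) := fun z =>
    (M.isAnnInfChar _).complexify (M.isAnnInfChar _)
  have hF₂ : ∀ z, IsAnnInfChar J (F₂ z) := fun z =>
    (M.isAnnInfChar _).complexify (M.isAnnInfChar _)
  -- Real and imaginary parts of such an infinitesimal character are again infinitesimal characters
  -- vanishing on `J`, so it is a point of the complexification of `E`.
  have hlift : ∀ ψ : ConvHom 𝕜 H (Complexification 𝕜 B), IsAnnInfChar J ψ →
      ∃ p : Complexification 𝕜 E, M.complexEvalMap p = ConvHom.evalMap ψ := by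
    intro ψ hψ
    obtain ⟨v, hv⟩ := M.exists_lie_eq hψ.re
    obtain ⟨w, hw⟩ := M.exists_lie_eq hψ.im
    refine ⟨Complexification.mk 𝕜 v w, ?_⟩
    rw [← ConvHom.complexify_re_im ψ, ← hv, ← hw]
    rfl
  choose g hg using fun z => hlift _ ((hF₁ z).convBCH M.isConilpotent M.annIsConvClosed (hF₂ z))
  refine ⟨univ, g, isOpen_univ, fun _ _ => mem_univ _, ?_, fun p _ => ?_⟩
  · refine isBastiani_of_mem_polyMaps M.complexEvalMap M.isClosedEmbedding_complexEvalMap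
      (fun x => ?_) _
    have h1 : EvalMem (polyMaps ℂ (Complexification 𝕜 (E × E)) (Complexification 𝕜 B)) F₁ :=
      fun x => clm_mem_polyMaps ⟨Complexification.map
        ((M.evalCLM x).comp (ContinuousLinearMap.fst 𝕜 E E)).toLinearMap,
        Complexification.continuous_map _ (ContinuousLinearMap.continuous _)⟩
    have h2 : EvalMem (polyMaps ℂ (Complexification 𝕜 (E × E)) (Complexification 𝕜 B)) F₂ :=
      fun x => clm_mem_polyMaps ⟨Complexification.map
        ((M.evalCLM x).comp (ContinuousLinearMap.snd 𝕜 E E)).toLinearMap,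
        Complexification.continuous_map _ (ContinuousLinearMap.continuous _)⟩
    simp only [hg]
    exact h1.convBCH const_mem_polyMaps M.isConilpotent h2
      (fun z => (hF₁ z).isInfinitesimalChar.map_one)
      (fun z => (hF₂ z).isInfinitesimalChar.map_one) x
  -- On `E × E` the extension agrees with `bchMap` by naturality along `B → B_ℂ`.
  · apply M.isClosedEmbedding_complexEvalMap.injective
    have hbase : ∀ v : E, ConvHom.complexify (ι v) (ι 0) =
        convPushforward Complexification.ofBaseAlgHom (ι v) := by
      intro v
      rw [map_zero]
      rfl
    have h1 : F₁ (Complexification.ofBase 𝕜 p) =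
        convPushforward Complexification.ofBaseAlgHom (ι p.1) := hbase p.1
    have h2 : F₂ (Complexification.ofBase 𝕜 p) =
        convPushforward Complexification.ofBaseAlgHom (ι p.2) := hbase p.2
    have h3 : M.complexEvalMap (Complexification.ofBase 𝕜 (M.bchMap p)) =
        ConvHom.evalMap (ConvHom.complexify (ι (M.bchMap p)) (ι 0)) := rfl
    have h4 := (M.isAnnInfChar p.1).isAnnChar_convExp M.isConilpotent M.annIsConvClosed
    have h5 := (M.isAnnInfChar p.2).isAnnChar_convExp M.isConilpotent M.annIsConvClosed
    rw [hg, h1, h2, h3, hbase, coe_bchMap,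
      convPushforward_convBCH _ (M.isPointwiseNilpotent _) (M.isPointwiseNilpotent _)
      ((h4.isConvChar.mul h5.isConvChar).isPointwiseNilpotent M.isConilpotent)]

theorem isCk_bchMap (U : Set (E × E)) (r : WithTop ℕ∞) (hr : r = ∞ ∨ r = ω) :
    IsCk 𝕜 r M.bchMap U := by
  obtain rfl | rfl := hr
  · exact M.isBastiani_bchMap U
  · exact ⟨fun _ => M.isRealAnalytic_bchMap U, fun _ => M.isBastiani_bchMap U⟩

end IsCharModel

end ExponentialModels

/-! ### Derivatives of powers and series, left invariant fields -/

section PowerDerivatives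

variable {𝕂 : Type*} [RCLike 𝕂] {E : Type*} [AddCommGroup E] [Module 𝕂 E]

/-- The derivative of `F ^ k` at a point where `F` has the value `c` and the derivative `v`. -/
def powDeriv {A : Type*} [Ring A] (c v : A) : ℕ → A
  | 0 => 0
  | k + 1 => powDeriv c v k * c + c ^ k * v

theorem powDeriv_zero_left {A : Type*} [Ring A] (v : A) (k : ℕ) :
    powDeriv 0 v k = if k = 1 then v else 0 := by
  match k with
  | 0 => simp [powDeriv]
  | 1 => simp [powDeriv]
  | k + 2 => simp [powDeriv]

variable {A : Type*} [Ring A] [Algebra 𝕂 A] [TopologicalSpace A] [IsTopologicalRing A]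
  [ContinuousSMul 𝕂 A]

theorem HasDirDeriv.pow {F : E → A} {x h : E} {v : A} (hF : HasDirDeriv 𝕂 F x h v) (k : ℕ) :
    HasDirDeriv 𝕂 (fun z => F z ^ k) x h (powDeriv (F x) v k) := by
  induction k with
  | zero => simpa only [pow_zero, powDeriv] using hasDirDeriv_const (1 : A) x h
  | succ k ih => simpa only [pow_succ, powDeriv] using ih.mul hF

/-- The second derivative of powers at a zero of the base. -/
theorem hasDirDeriv_powDeriv {F V : E → A} {x h : E} {v w : A} (hF : HasDirDeriv 𝕂 F x h v)
    (hV : HasDirDeriv 𝕂 V x h w) (hx : F x = 0) (k : ℕ) :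
    HasDirDeriv 𝕂 (fun z => powDeriv (F z) (V z) k) x h
      (if k = 1 then w else if k = 2 then V x * v + v * V x else 0) := by
  induction k with
  | zero => exact hasDirDeriv_const 0 x h
  | succ k ih =>
    have h1 := (ih.mul hF).add ((hF.pow k).mul hV)
    simp only [hx, mul_zero, zero_add, powDeriv_zero_left] at h1
    simp only [powDeriv]
    convert h1 using 1
    match k with
    | 0 => simp
    | 1 => simp
    | k + 2 => simp

end PowerDerivatives

section SeriesDerivatives

universe w u v

variable {𝕜 : Type u} [RCLike 𝕜] {H : Type v} [Ring H] [HopfAlgebra 𝕜 H]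
variable {B : Type w} [CommRing B] [Algebra 𝕜 B] [TopologicalSpace B]
variable {E : Type*} [AddCommGroup E] [Module 𝕜 E]

theorem hasDirDeriv_convHom_iff {F : E → ConvHom 𝕜 H B} {x h : E} {φ : ConvHom 𝕜 H B} :
    HasDirDeriv 𝕜 F x h φ ↔ ∀ a, HasDirDeriv 𝕜 (fun z => F z a) x h (φ a) := by
  rw [hasDirDeriv_iff_of_isInducing _ ConvHom.isInducing_evalMap, hasDirDeriv_pi]
  rfl

theorem HasDirDeriv.eval {F : E → ConvHom 𝕜 H B} {x h : E} {φ : ConvHom 𝕜 H B}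
    (hF : HasDirDeriv 𝕜 F x h φ) (a : H) : HasDirDeriv 𝕜 (fun z => F z a) x h (φ a) :=
  hasDirDeriv_convHom_iff.1 hF a

variable [IsTopologicalRing B] [ContinuousSMul 𝕜 B]

theorem HasDirDeriv.convSeries_apply {F : E → ConvHom 𝕜 H B} {x h : E} {φ : ConvHom 𝕜 H B}
    (hF : HasDirDeriv 𝕜 F x h φ) (hn : ∀ z, IsPointwiseNilpotent (F z)) (f : PowerSeries 𝕜) (a : H)
    (n : ℕ) (ha : ∀ z k, n ≤ k → (F z ^ k) a = 0) :
    HasDirDeriv 𝕜 (fun z => convSeries f (F z) a) x h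
      (∑ k ∈ Finset.range n, PowerSeries.coeff k f • powDeriv (F x) φ k a) := by
  simp only [fun z => _root_.convSeries_apply (hn z) f (ha z)]
  exact HasDirDeriv.sum _ fun k _ => ((hF.pow k).eval a).const_smul _

theorem HasDirDeriv.convExp {F : E → ConvHom 𝕜 H B} {x h : E} {φ : ConvHom 𝕜 H B}
    (hH : IsConilpotent.{w} 𝕜 H) (hF : HasDirDeriv 𝕜 F x h φ) (h1 : ∀ z, F z 1 = 0)
    (hx : F x = 0) : HasDirDeriv 𝕜 (fun z => convExp (F z)) x h φ := by
  refine hasDirDeriv_convHom_iff.2 fun a => ?_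
  obtain ⟨n, hn⟩ := hH a
  -- The bound `n + 2` guarantees that the index `1`, the only surviving one, lies in the range.
  have h2 := hF.convSeries_apply (fun z => hH.isPointwiseNilpotent (h1 z)) (PowerSeries.exp 𝕜) a
    (n + 2) (fun z k hk => hn B (F z) (h1 z) k (by omega))
  simp only [hx, powDeriv_zero_left] at h2
  rw [Finset.sum_eq_single 1] at h2
  · simpa [_root_.convExp] using h2
  · intro k _ hk
    simp [hk]
  · simp

end SeriesDerivatives

namespace IsCharModel

universe w u v

variable {𝕜 : Type u} [RCLike 𝕜] {H : Type v} [Ring H] [HopfAlgebra 𝕜 H]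
variable {B : Type w} [CommRing B] [Algebra 𝕜 B] [TopologicalSpace B]
variable {E : Type*} [AddCommGroup E] [Module 𝕜 E] [TopologicalSpace E]
variable {G : Type*} [Group G] [TopologicalSpace G]
variable {J : Set H} {ι : E →ₗ[𝕜] ConvHom 𝕜 H B} {γ : G →* ConvHom 𝕜 H B}
variable (M : IsCharModel J ι γ)
include M

/-- A bound for the order of nilpotency at `a`, large enough to see the terms of order two. -/
theorem exists_bound : ∃ N : H → ℕ, ∀ a, 3 ≤ N a ∧
    ∀ χ : ConvHom 𝕜 H B, χ 1 = 0 → ∀ k, N a ≤ k → (χ ^ k) a = 0 := by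
  choose N hN using M.isConilpotent
  exact ⟨fun a => N a + 3, fun a => ⟨Nat.le_add_left _ _, fun χ hχ k hk => hN a B χ hχ k (by dsimp only at hk; omega)⟩⟩

variable [IsTopologicalRing B] [ContinuousSMul 𝕜 B]

theorem hasDirDeriv_convExp (h : E) :
    HasDirDeriv 𝕜 (fun z => convExp (ι z)) 0 h (ι h) :=
  (ι.hasDirDeriv 0 h).convExp M.isConilpotent M.apply_one (map_zero ι)

variable [T2Space B]

/-- Differentiates `y ↦ log (exp x * exp y)` at `0`: the argument of `log` has derivative `exp x *
w`, and the logarithm series is differentiated term by term. The limit stays in `E` because `E` is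
closed in `H → B`. -/
theorem exists_leftInvariantField {N : H → ℕ} (hN : ∀ a, 3 ≤ N a ∧
    ∀ χ : ConvHom 𝕜 H B, χ 1 = 0 → ∀ k, N a ≤ k → (χ ^ k) a = 0) (w : E) :
    ∃ Y : E → E, ∀ x, HasDirDeriv 𝕜 (fun y => M.bchMap (x, y)) 0 w (Y x) ∧
      ∀ a, ι (Y x) a = ∑ k ∈ Finset.range (N a), PowerSeries.coeff k (logSeries 𝕜) •
        powDeriv (convExp (ι x) - 1) (convExp (ι x) * ι w) k a := by
  have key : ∀ x, ∃ u, (ConvHom.evalMap ∘ₗ ι) u = (fun a => ∑ k ∈ Finset.range (N a),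
      PowerSeries.coeff k (logSeries 𝕜) •
        powDeriv (convExp (ι x) - 1) (convExp (ι x) * ι w) k a) ∧
      HasDirDeriv 𝕜 (fun y => M.bchMap (x, y)) 0 w u := by
    intro x
    refine exists_hasDirDeriv_of_isClosedEmbedding _ M.isClosedEmbedding_evalMap
      (hasDirDeriv_pi.2 fun a => ?_)
    have h1 : HasDirDeriv 𝕜 (fun y => convExp (ι x) * convExp (ι y) - 1) 0 w
        (convExp (ι x) * ι w) := by
      have := ((hasDirDeriv_const (𝕂 := 𝕜) (convExp (ι x)) 0 w).mul (M.hasDirDeriv_convExp w)).sub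
        (hasDirDeriv_const 1 0 w)
      simpa only [zero_mul, zero_add, sub_zero] using this
    have hone : ∀ y, (convExp (ι x) * convExp (ι y) - 1) 1 = 0 := by
      intro y
      rw [WithConv.ofConv_sub, LinearMap.sub_apply, ConvHom.mul_apply_one, ConvHom.one_apply_one,
        convExp_apply_one (M.isPointwiseNilpotent x) (M.apply_one x),
        convExp_apply_one (M.isPointwiseNilpotent y) (M.apply_one y), mul_one, sub_self]
    have h2 := h1.convSeries_apply (fun y => M.isConilpotent.isPointwiseNilpotent (hone y))
      (logSeries 𝕜) a (N a) (fun y => (hN a).2 _ (hone y))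
    rw [map_zero, convExp_zero, mul_one] at h2
    refine Eq.mp ?_ h2
    congr 1
    funext y
    exact congrArg (fun φ : ConvHom 𝕜 H B => φ a) (M.coe_bchMap (x, y)).symm
  choose Y hY hY' using key
  exact ⟨Y, fun x => ⟨hY' x, fun a => congrFun (hY x) a⟩⟩

/-- As `exp x - 1` vanishes at `x = 0`, only the logarithm coefficients `1` and `-1/2` contribute.
The result `v w - (w v + v w) / 2` is half of the commutator. -/
theorem exists_hasDirDeriv_leftInvariantField {N : H → ℕ} (hN : ∀ a, 3 ≤ N a) {v w : E}
    {Y : E → E} (hY : ∀ x a, ι (Y x) a = ∑ k ∈ Finset.range (N a),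
      PowerSeries.coeff k (logSeries 𝕜) •
        powDeriv (convExp (ι x) - 1) (convExp (ι x) * ι w) k a) :
    ∃ u, HasDirDeriv 𝕜 Y 0 v u ∧
      ι u = ι v * ι w - (2 : 𝕜)⁻¹ • (ι w * ι v + ι v * ι w) := by
  have h0 := M.hasDirDeriv_convExp v
  have h1 : HasDirDeriv 𝕜 (fun x => convExp (ι x) - 1) 0 v (ι v) := by
    have := h0.sub (hasDirDeriv_const 1 0 v)
    simpa only [sub_zero] using this
  have h2 : HasDirDeriv 𝕜 (fun x => convExp (ι x) * ι w) 0 v (ι v * ι w) := by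
    have := h0.mul (hasDirDeriv_const (ι w) 0 v)
    simpa only [mul_zero, add_zero] using this
  have h3 := fun k => hasDirDeriv_powDeriv h1 h2 (by rw [map_zero, convExp_zero, sub_self]) k
  simp only [map_zero, convExp_zero, one_mul] at h3
  have h4 : ∀ a, HasDirDeriv 𝕜 (fun x => ι (Y x) a) 0 v
      ((ι v * ι w - (2 : 𝕜)⁻¹ • (ι w * ι v + ι v * ι w) : ConvHom 𝕜 H B) a) := by
    intro a
    simp only [hY]
    have h5 := HasDirDeriv.sum (Finset.range (N a)) fun k _ =>
      ((h3 k).eval a).const_smul (PowerSeries.coeff k (logSeries 𝕜))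
    refine Eq.mp ?_ h5
    congr 1
    -- The bound `3 ≤ N a` places both surviving indices in the range.
    rw [← Finset.sum_subset (s₁ := {1, 2})]
    · rw [Finset.sum_pair (by norm_num)]
      simp only [if_true, coeff_logSeries_one, coeff_logSeries_two, if_neg (by norm_num : ¬ 2 = 1)]
      rw [WithConv.ofConv_sub, LinearMap.sub_apply, ConvHom.coe_smul]
      module
    · intro k hk
      have := hN a
      simp only [Finset.mem_insert, Finset.mem_singleton] at hk
      simp only [Finset.mem_range]
      omega
    · intro k _ hk
      simp only [Finset.mem_insert, Finset.mem_singleton, not_or] at hk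
      rw [if_neg hk.1, if_neg hk.2]
      simp
  obtain ⟨u, hu, hu'⟩ := exists_hasDirDeriv_of_isClosedEmbedding _ M.isClosedEmbedding_lie
    (hasDirDeriv_convHom_iff.2 h4)
  exact ⟨u, hu', hu⟩

end IsCharModel

/-! ### Lie groups with one global chart -/

section SingleCharts

variable {𝕜 : Type*} [RCLike 𝕜]
variable {E : Type*} [AddCommGroup E] [Module 𝕜 E] [TopologicalSpace E]
variable {E' : Type*} [AddCommGroup E'] [Module 𝕜 E'] [TopologicalSpace E']
variable {M : Type*} [TopologicalSpace M] {M' : Type*} [TopologicalSpace M']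

theorem isMfdMapOn_singleton {r : WithTop ℕ∞} {e : OpenPartialHomeomorph M E}
    {e' : OpenPartialHomeomorph M' E'} {f : M → M'} {U : Set M} (hU : IsOpen U)
    (hf : Continuous f) (h : ∀ V, IsCk 𝕜 r (e' ∘ f ∘ e.symm) V) :
    IsMfdMapOn 𝕜 r {e} {e'} f U := by
  refine ⟨hU, hf.continuousOn, ?_⟩
  rintro _ rfl _ rfl
  exact h _

theorem chartCompatible_homeomorph (r : WithTop ℕ∞) (e : M ≃ₜ E) :
    ChartCompatible 𝕜 r e.toOpenPartialHomeomorph e.toOpenPartialHomeomorph := by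
  have h : (e.toOpenPartialHomeomorph ∘ e.toOpenPartialHomeomorph.symm : E → E) = id := by
    funext v
    exact e.apply_symm_apply v
  rw [ChartCompatible, h]
  exact ⟨(LinearMap.id (R := 𝕜) (M := E)).isLinear.isCk continuous_id r _,
    (LinearMap.id (R := 𝕜) (M := E)).isLinear.isCk continuous_id r _⟩

theorem isLCManifold_homeomorph (r : WithTop ℕ∞) (e : M ≃ₜ E) (hE : IsLCSpace 𝕜 E) :
    IsLCManifold 𝕜 r {e.toOpenPartialHomeomorph} where
  covers x := ⟨_, rfl, mem_univ x⟩
  compatible := by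
    rintro _ rfl _ rfl
    exact chartCompatible_homeomorph r e
  hausdorff := by
    have := hE.t2
    exact e.isEmbedding.t2Space
  model := hE

end SingleCharts

namespace IsCharModel

universe w u v

variable {𝕜 : Type u} [RCLike 𝕜] {H : Type v} [Ring H] [HopfAlgebra 𝕜 H]
variable {B : Type w} [CommRing B] [Algebra 𝕜 B] [TopologicalSpace B]
variable {E : Type*} [AddCommGroup E] [Module 𝕜 E] [TopologicalSpace E]
variable {G : Type*} [Group G] [TopologicalSpace G]
variable {J : Set H} {ι : E →ₗ[𝕜] ConvHom 𝕜 H B} {γ : G →* ConvHom 𝕜 H B}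
variable (M : IsCharModel J ι γ) [IsTopologicalRing B]

include M

/-- The chart inverse to the exponential map. -/
noncomputable def chart : OpenPartialHomeomorph G E := M.expHomeo.symm.toOpenPartialHomeomorph

theorem chart_apply (g : G) : M.chart g = M.expHomeo.symm g := rfl

theorem chart_symm_apply (v : E) : M.chart.symm v = M.expHomeo v := rfl

theorem chart_one : M.chart 1 = 0 := M.expHomeo_symm_one

theorem coe_chart (g : G) : ι (M.chart g) = convLog (γ g) := M.coe_expHomeo_symm g

theorem coe_chart_symm (v : E) : γ (M.chart.symm v) = convExp (ι v) := M.coe_expHomeo v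

/-- A global chart inverse to the exponential is unique; this makes `expAtlas` a singleton. -/
theorem chart_eq {e : OpenPartialHomeomorph G E} (hs : e.source = univ)
    (h : ∀ v, γ (e.symm v) = convExp (ι v)) : e = M.chart := by
  have h1 : ∀ v, e.symm v = M.chart.symm v := fun v =>
    M.isEmbedding_group.injective ((h v).trans (M.coe_chart_symm v).symm)
  refine OpenPartialHomeomorph.ext _ _ (fun g => ?_) h1 (hs.trans rfl)
  have h2 : e.symm (e g) = g := e.left_inv (hs ▸ mem_univ g)
  rw [h1, chart_symm_apply] at h2
  rw [chart_apply, Homeomorph.eq_symm_apply, h2]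

theorem chartCompatible (r : WithTop ℕ∞) : ChartCompatible 𝕜 r M.chart M.chart :=
  chartCompatible_homeomorph r M.expHomeo.symm

theorem isTopologicalAddGroup_lie : IsTopologicalAddGroup E :=
  M.isEmbedding_lie.isInducing.topologicalAddGroup ι

theorem isTopologicalGroup : IsTopologicalGroup G where
  continuous_mul := by
    rw [M.isEmbedding_group.continuous_iff]
    have h := M.isEmbedding_group.continuous
    refine ((h.comp continuous_fst).mul (h.comp continuous_snd)).congr fun p => ?_
    exact (map_mul γ p.1 p.2).symm
  continuous_inv := by
    have := M.isTopologicalAddGroup_lie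
    refine (M.expHomeo.continuous.comp (M.expHomeo.symm.continuous.neg)).congr fun g => ?_
    rw [Function.comp_apply, Pi.neg_apply, expHomeo_neg, Homeomorph.apply_symm_apply]

variable {L : Type*} [LieRing L] [LieAlgebra 𝕜 L] [TopologicalSpace L] (θ : L ≃L[𝕜] E)
variable {A : Set (OpenPartialHomeomorph G E)} (hA : A = {M.chart})
section

include hA

theorem coe_eq_chart (c : {e // e ∈ A ∧ (1 : G) ∈ e.source}) : c.1 = M.chart :=
  hA.le c.2.1

/-- The identification of the Lie algebra with the tangent space at `1`. -/
def tangentMap (v : L) : TangentVec 𝕜 A (1 : G) where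
  coord _ := θ v
  compat c c' := by
    have h : (M.chart ∘ M.chart.symm : E → E) = (LinearMap.id : E →ₗ[𝕜] E) := by
      funext v
      exact M.expHomeo.symm_apply_apply v
    rw [M.coe_eq_chart hA c, M.coe_eq_chart hA c', h]
    exact LinearMap.hasDirDeriv _ _ _

theorem tangentMap_coord (v : L) (c) : (M.tangentMap θ hA v).coord c = θ v := rfl

theorem isMfdMapOn_exp (r : WithTop ℕ∞) (U : Set L) (hU : IsOpen U) :
    IsMfdMapOn 𝕜 r (idAtlas L) A (fun v => M.expHomeo (θ v)) U := by
  rw [hA]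
  refine isMfdMapOn_singleton hU (M.expHomeo.continuous.comp θ.continuous) fun V => ?_
  have h : (M.chart ∘ (fun v => M.expHomeo (θ v)) ∘ (OpenPartialHomeomorph.refl L).symm : L → E) =
      θ := by
    funext v
    exact M.expHomeo.symm_apply_apply _
  rw [h]
  exact θ.toLinearMap.isLinear.isCk θ.continuous r V

theorem isMfdMapOn_log (r : WithTop ℕ∞) (U : Set G) (hU : IsOpen U) :
    IsMfdMapOn 𝕜 r A (idAtlas L) (fun g => θ.symm (M.expHomeo.symm g)) U := by
  rw [hA]
  refine isMfdMapOn_singleton hU (θ.symm.continuous.comp M.expHomeo.symm.continuous) fun V => ?_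
  have h : (OpenPartialHomeomorph.refl L ∘ (fun g => θ.symm (M.expHomeo.symm g)) ∘ M.chart.symm :
      E → L) = θ.symm := by
    funext v
    exact congrArg θ.symm (M.expHomeo.symm_apply_apply _)
  rw [h]
  exact θ.symm.toLinearMap.isLinear.isCk θ.symm.continuous r V

/-- In the logarithmic chart the exponential map is the linear map `θ` and `t ↦ exp (t v)` is a
line, so every smoothness claim concerns a continuous linear map. -/
theorem isSmoothLieExp [ContinuousSMul 𝕜 B] : IsSmoothLieExp 𝕜 A (M.tangentMap θ hA) fun v => M.expHomeo (θ v) := by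
  let _ : Module ℝ E := Module.compHom E (algebraMap ℝ 𝕜)
  have := M.isTopologicalAddGroup_lie
  have hsmul : ContinuousSMul 𝕜 E := ⟨by
    rw [M.isEmbedding_lie.continuous_iff]
    refine (continuous_fst.smul (M.isEmbedding_lie.continuous.comp continuous_snd)).congr
      fun p => ?_
    exact (map_smul ι p.1 p.2).symm⟩
  have hline : ∀ v : E, IsLinearMap ℝ fun t : ℝ => (t : 𝕜) • v := fun v =>
    ⟨fun s t => by rw [RCLike.ofReal_add, add_smul], fun s t => by
      rw [smul_eq_mul, RCLike.ofReal_mul, mul_smul]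
      rfl⟩
  have hlinec : ∀ v : E, Continuous fun t : ℝ => (t : 𝕜) • v := fun v =>
    RCLike.continuous_ofReal.smul continuous_const
  have hchart : ∀ v : L, (fun t : ℝ => M.chart (M.expHomeo (θ ((t : 𝕜) • v)))) =
      fun t : ℝ => (t : 𝕜) • θ v := fun v => by
    funext t
    rw [chart_apply, Homeomorph.symm_apply_apply, map_smul]
  refine ⟨fun v => ⟨fun s t => ?_, ?_, fun c => ?_⟩, ?_⟩
  · simp only [RCLike.ofReal_add, map_smul]
    exact M.expHomeo_add_smul _ _ _
  · rw [hA]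
    refine isMfdMapOn_singleton isOpen_univ ?_ fun V => ?_
    · simp only [map_smul]
      exact M.expHomeo.continuous.comp (hlinec (θ v))
    · have := (hline (θ v)).isCk (hlinec (θ v)) ∞ V
      rw [← hchart] at this
      exact this
  · rw [M.coe_eq_chart hA c, hchart, tangentMap_coord]
    have := (hline (θ v)).hasDirDeriv 0 1
    rwa [RCLike.ofReal_one, one_smul] at this
  · exact M.isMfdMapOn_exp θ hA ∞ univ isOpen_univ

end

variable [T2Space B] [ContinuousSMul 𝕜 B]

theorem isLCSpace [PolynormableSpace 𝕜 B] : IsLCSpace 𝕜 E where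
  t2 := M.t2Space_lie
  polynormable := M.isClosedEmbedding_evalMap.isInducing.polynormableSpace

theorem isLCLieGroup [PolynormableSpace 𝕜 B] (r : WithTop ℕ∞) (hr : r = ∞ ∨ r = ω) :
    IsLCLieGroup 𝕜 r {M.chart} where
  manifold := isLCManifold_homeomorph r M.expHomeo.symm M.isLCSpace
  mul := by
    have := M.isTopologicalGroup
    rw [prodAtlas, image2_singleton]
    refine isMfdMapOn_singleton isOpen_univ continuous_mul fun V => ?_
    exact M.isCk_bchMap V r hr
  inv := by
    have := M.isTopologicalGroup
    have := M.isTopologicalAddGroup_lie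
    refine isMfdMapOn_singleton isOpen_univ continuous_inv fun V => ?_
    have h : (M.chart ∘ (fun g : G => g⁻¹) ∘ M.chart.symm : E → E) =
        (-LinearMap.id : E →ₗ[𝕜] E) := by
      funext v
      rw [Function.comp_apply, Function.comp_apply, chart_symm_apply, ← expHomeo_neg, chart_apply,
        Homeomorph.symm_apply_apply]
      rfl
    rw [h]
    exact (-LinearMap.id : E →ₗ[𝕜] E).isLinear.isCk continuous_neg r V

include hA

theorem isLieAlgebraOf (hθ : ∀ v w, ι (θ ⁅v, w⁆) = ι (θ v) * ι (θ w) - ι (θ w) * ι (θ v)) :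
    IsLieAlgebraOf 𝕜 A (M.tangentMap θ hA) where
  linear _ := θ.toLinearMap.isLinear
  homeo _ := θ.toHomeomorph.isHomeomorph
  bracket v w c := by
    simp only [tangentMap_coord]
    rw [M.coe_eq_chart hA c]
    obtain ⟨N, hN⟩ := M.exists_bound
    obtain ⟨X, hX⟩ := M.exists_leftInvariantField hN (θ v)
    obtain ⟨Y, hY⟩ := M.exists_leftInvariantField hN (θ w)
    obtain ⟨a, ha, ha'⟩ := M.exists_hasDirDeriv_leftInvariantField (fun x => (hN x).1) (v := θ v)
      (w := θ w) fun x => (hY x).2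
    obtain ⟨b, hb, hb'⟩ := M.exists_hasDirDeriv_leftInvariantField (fun x => (hN x).1) (v := θ w)
      (w := θ v) fun x => (hX x).2
    refine ⟨X, Y, a, b, fun x _ => ?_, fun x _ => ?_, ?_, ?_, ?_⟩
    · rw [chart_one]
      exact (hX x).1
    · rw [chart_one]
      exact (hY x).1
    · rwa [chart_one]
    · rwa [chart_one]
    -- The two derivatives are half commutators of opposite sign, so their difference is the full
    -- commutator.
    · apply M.isEmbedding_lie.injective
      rw [hθ, map_sub, ha', hb']
      module

theorem isExponentialLieGroup [PolynormableSpace 𝕜 B]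
    (hθ : ∀ v w, ι (θ ⁅v, w⁆) = ι (θ v) * ι (θ w) - ι (θ w) * ι (θ v)) :
    IsExponentialLieGroup 𝕜 A (M.tangentMap θ hA) := by
  refine ⟨hA ▸ M.isLCLieGroup ∞ (Or.inl rfl), M.isLieAlgebraOf θ hA hθ, _, _,
    M.isSmoothLieExp θ hA, fun v => ?_, fun g => ?_, M.isMfdMapOn_log θ hA ∞ univ isOpen_univ⟩
  · simp
  · simp

theorem isBCHLieGroup [PolynormableSpace 𝕜 B]
    (hθ : ∀ v w, ι (θ ⁅v, w⁆) = ι (θ v) * ι (θ w) - ι (θ w) * ι (θ v)) :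
    IsBCHLieGroup 𝕜 A (M.tangentMap θ hA) :=
  ⟨hA ▸ M.isLCLieGroup ω (Or.inr rfl), M.isLieAlgebraOf θ hA hθ, _,
    M.isSmoothLieExp θ hA, (θ.toHomeomorph.trans M.expHomeo).toOpenPartialHomeomorph,
    mem_univ _, fun _ _ => rfl, M.isMfdMapOn_exp θ hA ω _ isOpen_univ,
    M.isMfdMapOn_log θ hA ω _ isOpen_univ⟩

end IsCharModel

/-! ### The two models: all characters and the annihilator subgroup -/

section ExponentialSeries

variable {𝕜 : Type*} [RCLike 𝕜] {H : Type*} [Ring H] [HopfAlgebra 𝕜 H]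
variable {B : Type*} [CommRing B] [Algebra 𝕜 B] [TopologicalSpace B]

theorem hasSum_convExp {ψ : ConvHom 𝕜 H B} (h : IsPointwiseNilpotent ψ) :
    HasSum (fun k : ℕ => ((k.factorial : 𝕜)⁻¹) • ψ ^ k) (convExp ψ) := by
  rw [HasSum, ConvHom.isInducing_evalMap.tendsto_nhds_iff, tendsto_pi_nhds]
  intro x
  obtain ⟨n, hn⟩ := h x
  have h1 : HasSum (fun k : ℕ => ((k.factorial : 𝕜)⁻¹) • (ψ ^ k) x) (convExp ψ x) := by
    rw [convExp, convSeries_apply h _ hn]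
    simp only [coeff_exp_eq]
    refine hasSum_sum_of_ne_finset_zero fun k hk => ?_
    rw [hn k (by simpa using hk), smul_zero]
  refine Tendsto.congr (fun s => ?_) h1
  exact (ConvHom.coe_sum s (fun k => ((k.factorial : 𝕜)⁻¹) • ψ ^ k) x).symm

instance [T2Space B] : T2Space (ConvHom 𝕜 H B) :=
  IsEmbedding.t2Space (f := (ConvHom.evalMap : ConvHom 𝕜 H B →ₗ[𝕜] H → B))
    ⟨ConvHom.isInducing_evalMap, fun _ _ h => ConvHom.ext_apply (congrFun h)⟩

variable (𝕜 H B) in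
/-- The inclusion of the group of characters into the convolution algebra. -/
noncomputable def CharGroup.toHomMonoidHom : CharGroup 𝕜 H B →* ConvHom 𝕜 H B where
  toFun := CharGroup.toHom
  map_one' := rfl
  map_mul' := CharGroup.toHom_mul

theorem CharGroup.isEmbedding_toHom :
    IsEmbedding (CharGroup.toHom : CharGroup 𝕜 H B → ConvHom 𝕜 H B) :=
  ⟨⟨rfl⟩, CharGroup.toHom_injective⟩

end ExponentialSeries

section Models

universe w u v

variable {𝕜 : Type u} [RCLike 𝕜] {H : Type v} [Ring H] [HopfAlgebra 𝕜 H]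
variable {B : Type w} [CommRing B] [Algebra 𝕜 B] [TopologicalSpace B]

theorem isCharModel_infChar (hH : IsConilpotent.{w} 𝕜 H) :
    IsCharModel (∅ : Set H) (infChar 𝕜 H B).toSubmodule.subtype
      (CharGroup.toHomMonoidHom 𝕜 H B) where
  isEmbedding_lie := IsEmbedding.subtypeVal
  range_lie := by
    ext ψ
    constructor
    · rintro ⟨v, rfl⟩
      exact ⟨v.2, fun x hx => hx.elim⟩
    · exact fun h => ⟨⟨ψ, h.1⟩, rfl⟩
  isEmbedding_group := CharGroup.isEmbedding_toHom
  range_group := by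
    ext φ
    constructor
    · rintro ⟨g, rfl⟩
      exact ⟨g.isConvChar_toHom, fun x hx => hx.elim⟩
    · exact fun h => ⟨h.1.toCharGroup, h.1.toHom_toCharGroup⟩
  isConilpotent := hH
  annIsConvClosed := fun _ _ _ _ _ _ _ _ hx => hx.elim

variable (J : Ideal H) [J.IsHopfIdeal 𝕜]

variable (𝕜) in
theorem counit_eq_zero_of_mem_hopfIdeal {x : H} (hx : x ∈ J) : Coalgebra.counit (R := 𝕜) x = 0 :=
  Submodule.IsCoideal.counit_eq_zero (I := J.restrictScalars 𝕜) hx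

omit [TopologicalSpace B] in
theorem sub_one_apply_of_mem_hopfIdeal (φ : ConvHom 𝕜 H B) {x : H} (hx : x ∈ J) :
    (φ - 1) x = φ x := by
  rw [WithConv.ofConv_sub, LinearMap.sub_apply, LinearMap.convOne_apply,
    counit_eq_zero_of_mem_hopfIdeal 𝕜 J hx, map_zero, sub_zero]

/-- The counit vanishes on a Hopf ideal, so agreeing with the counit on `J` means vanishing on `J`;
closure under convolution is the coideal property. -/
theorem isCharModel_annInfChar (hH : IsConilpotent.{w} 𝕜 H) :
    IsCharModel (J : Set H)
      ((infChar 𝕜 H B).toSubmodule.subtype ∘ₗ (annInfChar 𝕜 B J).toSubmodule.subtype)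
      ((CharGroup.toHomMonoidHom 𝕜 H B).comp (annChar 𝕜 B J).subtype) where
  isEmbedding_lie := IsEmbedding.subtypeVal.comp IsEmbedding.subtypeVal
  range_lie := by
    ext ψ
    constructor
    · rintro ⟨v, rfl⟩
      exact ⟨v.1.2, v.2⟩
    · exact fun h => ⟨⟨⟨ψ, h.1⟩, h.2⟩, rfl⟩
  isEmbedding_group := CharGroup.isEmbedding_toHom.comp IsEmbedding.subtypeVal
  range_group := by
    ext φ
    constructor
    · rintro ⟨g, rfl⟩
      refine ⟨g.1.isConvChar_toHom, fun x hx => ?_⟩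
      rw [sub_one_apply_of_mem_hopfIdeal J _ hx]
      exact g.2 x hx
    · refine fun h => ⟨⟨h.1.toCharGroup, fun x hx => ?_⟩, h.1.toHom_toCharGroup⟩
      rw [h.1.toHom_toCharGroup, ← sub_one_apply_of_mem_hopfIdeal J _ hx]
      exact h.2 x hx
  isConilpotent := hH
  annIsConvClosed := fun _ _ _ _ _ hφ hχ _ hx => ConvHom.ann_mul J hφ hχ hx

theorem expAtlas_eq [T2Space B] [IsTopologicalRing B]
    (M : IsCharModel (∅ : Set H) (infChar 𝕜 H B).toSubmodule.subtype
      (CharGroup.toHomMonoidHom 𝕜 H B)) : expAtlas 𝕜 H B = {M.chart} := by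
  ext e
  rw [mem_singleton_iff]
  constructor
  · rintro ⟨hs, -, h⟩
    exact M.chart_eq hs fun v => (h v).unique (hasSum_convExp (M.isPointwiseNilpotent v))
  · rintro rfl
    refine ⟨rfl, rfl, fun v => ?_⟩
    have h := hasSum_convExp (M.isPointwiseNilpotent v)
    rw [← M.coe_chart_symm] at h
    exact h

end Models

/-! ### The main theorem -/

theorem mainTheorem5 {𝕜 : Type*} [RCLike 𝕜] {H : Type*} [Ring H] [HopfAlgebra 𝕜 H]
    (𝒢 : ℕ → Submodule 𝕜 H) (h𝒢 : IsConnectedHopfGrading 𝕜 𝒢)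
    (J : Ideal H) [J.IsTwoSided] [J.IsHopfIdeal 𝕜]
    {B : Type*} [CommRing B] [Algebra 𝕜 B] [TopologicalSpace B] [T2Space B]
    [PolynormableSpace 𝕜 B] [ContinuousMul B] :
    IsLCLieGroup 𝕜 ω (expAtlas 𝕜 H B) ∧
    ∃ τ : infChar 𝕜 H B → TangentVec 𝕜 (expAtlas 𝕜 H B) 1,
      IsLieAlgebraOf 𝕜 (expAtlas 𝕜 H B) τ ∧
      (∀ ψ c, HasDirDeriv 𝕜 (CharGroup.toHom ∘ c.1.symm) (c.1 1) ((τ ψ).coord c)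
        (ψ : ConvHom 𝕜 H B)) ∧
      IsClosed (annChar 𝕜 B J : Set (CharGroup 𝕜 H B)) ∧
      ∃ A : Set (OpenPartialHomeomorph (annChar 𝕜 B J) (annInfChar 𝕜 B J).toSubmodule),
        IsLieSubgroup 𝕜 ω (expAtlas 𝕜 H B) (annChar 𝕜 B J) (annInfChar 𝕜 B J).toSubmodule A ∧
        ∃ σ : annInfChar 𝕜 B J → TangentVec 𝕜 A 1,
          IsLieAlgebraOf 𝕜 A σ ∧
          (∀ ψ, HasTangentMap 𝕜 Subtype.val (σ ψ) (τ ψ)) ∧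
          IsExponentialLieGroup 𝕜 A σ ∧ IsBCHLieGroup 𝕜 A σ := by
  have : IsTopologicalAddGroup B := (PolynormableSpace.withSeminorms 𝕜 B).topologicalAddGroup
  have : IsTopologicalRing B := {}
  have : ContinuousSMul 𝕜 B := (PolynormableSpace.withSeminorms 𝕜 B).continuousSMul
  have hH := h𝒢.isConilpotent
  have M := isCharModel_infChar (B := B) hH
  have N := isCharModel_annInfChar (B := B) J hH
  have hM := expAtlas_eq M
  let θ : infChar 𝕜 H B ≃L[𝕜] (infChar 𝕜 H B).toSubmodule := ContinuousLinearEquiv.refl 𝕜 _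
  let κ : annInfChar 𝕜 B J ≃L[𝕜] (annInfChar 𝕜 B J).toSubmodule := ContinuousLinearEquiv.refl 𝕜 _
  have hκ : ∀ v w : annInfChar 𝕜 B J, ((⁅v, w⁆ : infChar 𝕜 H B) : ConvHom 𝕜 H B) =
      v * w - w * v := fun v w => rfl
  -- Both charts are the logarithm, so that of the subgroup is a restriction of that of the whole
  -- group.
  have hchart : ∀ y : annChar 𝕜 B J, (N.chart y : infChar 𝕜 H B) = M.chart y := fun y =>
    M.isEmbedding_lie.injective ((N.coe_chart y).trans (M.coe_chart y).symm)
  refine ⟨hM ▸ M.isLCLieGroup ω (Or.inr rfl), M.tangentMap θ hM, M.isLieAlgebraOf θ hM ?_, ?_, ?_,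
    {N.chart}, ?_, N.tangentMap κ rfl, N.isLieAlgebraOf κ rfl hκ, ?_,
    N.isExponentialLieGroup κ rfl hκ, N.isBCHLieGroup κ rfl hκ⟩
  · exact fun v w => rfl
  · intro ψ c
    rw [M.coe_eq_chart hM c, M.chart_one, M.tangentMap_coord]
    refine Eq.mp ?_ (M.hasDirDeriv_convExp (θ ψ))
    congr 1
    funext v
    exact (M.coe_chart_symm v).symm
  · have h : (annChar 𝕜 B J : Set (CharGroup 𝕜 H B)) =
        CharGroup.toHom ⁻¹' {φ | ∀ x ∈ J, φ x = 0} := rfl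
    rw [h]
    refine IsClosed.preimage CharGroup.isEmbedding_toHom.continuous ?_
    simp only [ofPred_forall]
    exact isClosed_iInter fun x => isClosed_iInter fun _ =>
      isClosed_eq (ConvHom.continuous_eval x) continuous_const
  · refine ⟨?_, ?_, N.isLCLieGroup ω (Or.inr rfl)⟩
    · have h : ((annInfChar 𝕜 B J).toSubmodule : Set (infChar 𝕜 H B)) =
          Subtype.val ⁻¹' {φ : ConvHom 𝕜 H B | ∀ x ∈ J, φ x = 0} := rfl
      rw [h]
      refine IsClosed.preimage continuous_subtype_val ?_
      simp only [ofPred_forall]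
      exact isClosed_iInter fun x => isClosed_iInter fun _ =>
        isClosed_eq (ConvHom.continuous_eval x) continuous_const
    · rintro _ rfl
      refine ⟨M.chart, ?_, fun x _ => ?_, fun y => Iff.rfl, fun y _ => hchart y⟩
      · intro e' he'
        rw [hM] at he'
        rw [mem_singleton_iff.1 he']
        exact M.chartCompatible ω
      · constructor
        · intro hx
          rw [← hchart ⟨x, hx⟩]
          exact (N.chart ⟨x, hx⟩).2
        · intro hx
          -- If `log x` annihilates `J`, its exponential formed inside the subgroup has the same
          -- logarithm as `x`, hence equals `x`.
          have h1 : ((N.chart.symm ⟨M.chart x, hx⟩ : annChar 𝕜 B J) : CharGroup 𝕜 H B) = x := by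
            apply M.expHomeo.symm.injective
            refine (hchart _).symm.trans ?_
            exact congrArg Subtype.val (N.expHomeo.symm_apply_apply _)
          rw [← h1]
          exact SetLike.coe_mem _
  · refine fun ψ => ⟨rfl, fun c c' => ?_⟩
    rw [N.coe_eq_chart rfl c, M.coe_eq_chart hM c', M.tangentMap_coord, N.tangentMap_coord]
    -- In the charts the inclusion of groups is the inclusion of the closed subspace, which is its
    -- own derivative.
    have h : (M.chart ∘ Subtype.val ∘ N.chart.symm :
        (annInfChar 𝕜 B J).toSubmodule → infChar 𝕜 H B) =
        Subtype.val := by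
      funext v
      refine (hchart _).symm.trans ?_
      exact congrArg Subtype.val (N.expHomeo.symm_apply_apply v)
    rw [h]
    exact IsLinearMap.hasDirDeriv ⟨fun _ _ => rfl, fun _ _ => rfl⟩ _ _
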